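/- Let $\|\cdot\|$ denote the Euclidean norm of a vector and the spectral norm of a matrix. Let $(\mathbf Z_t)_{t\in\mathbb Z}$ be an i.i.d. sequence of $\mathbb R^k$-valued random vectors with $\mathbb E[\mathbf Z_0]=0$ and $\mathbb E\|\mathbf Z_0\|^2<\infty$, let $(A_j)_{j\ge 0}$ be real $k\times k$ matrices with $\sum_{j\ge 0}\|A_j\|<\infty$, and let $\mathbf X_t=\sum_{j=0}^\infty A_j\mathbf Z_{t-j}$ almost surely, for $t\ge 1$. Let $f_1,\dots,f_M:\mathbb R^k\to\mathbb R$ be Lipschitz continuous, and let $a_{t,m}^{(n)}\in\mathbb R$ ($n\ge1$, $t\in\mathbb Z$, $1\le m\le M$) be deterministic weights with $a_{t,m}^{(n)}=0$ whenever $t\notin\{1,\dots,n\}$. Assume that for all $m,\ell\in\{1,\dots,M\}$ and all $h\in\mathbb Z$ there is a real number $G_{m\ell}(h)$ with $$\text{(W1)}\qquad \frac1n\sum_{t=1}^n a_{t,m}^{(n)}a_{t+h,\ell}^{(n)}\xrightarrow[n\to\infty]{} G_{m\ell}(h),$$ and that $$\text{(W2)}\qquad \max_{1\le t\le n}\max_{1\le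 m\le M}|a_{t,m}^{(n)}|=o(\sqrt n)\qquad (n\to\infty).$$ Put $S_{m,n}=\sum_{t=1}^n a_{t,m}^{(n)}\big(f_m(\mathbf X_t)-\mathbb E[f_m(\mathbf X_t)]\big)$ and $$L_{m\ell}=G_{m\ell}(0)\operatorname{Cov}\big(f_m(\mathbf X_1),f_\ell(\mathbf X_1)\big)+2\sum_{h=1}^\infty G_{m\ell}(h)\operatorname{Cov}\big(f_m(\mathbf X_1),f_\ell(\mathbf X_{1+h})\big).$$ Then all $f_m(\mathbf X_t)$, $t\ge1$, are square-integrable, the series defining each $L_{m\ell}$ converges absolutely, the matrix $\Sigma=(\Sigma_{m\ell})_{m,\ell=1}^M$ with entries $$\Sigma_{m\ell}=\tfrac12\,(L_{m\ell}+L_{\ell m})$$ is positive semidefinite, and, as $n\to\infty$, $$\frac1{\sqrt n}\,(S_{1,n},\dots,S_{M,n})^\top\xrightarrow{\ \mathcal D\ }\mathcal N(0,\Sigma).$$ In particular $\Sigma_{mm}=L_{mm}$ for every $m$. -/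

import Mathlib

open MeasureTheory ProbabilityTheory Filter
open scoped Topology NNReal

/-- `X` is (on the time axis `t ≥ 1`) the causal linear process `X t = ∑_{j ≥ 0} A j (Z (t - j))`,
with i.i.d. centered square-integrable innovations `Z t`, `t ∈ ℤ`, in Euclidean `ℝ^k` and real
`k × k` coefficient matrices `A j` whose spectral norms are summable.

`Matrix.toEuclideanCLM (A j)` is the operator `x ↦ A j x` of the Euclidean space, so that its
operator norm is the spectral norm of `A j`. -/
structure IsLinearProcess {Ω : Type*} [MeasurableSpace Ω] (P : Measure Ω) {k : ℕ}
    (A : ℕ → Matrix (Fin k) (Fin k) ℝ) (Z : ℤ → Ω → EuclideanSpace ℝ (Fin k))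
    (X : ℕ → Ω → EuclideanSpace ℝ (Fin k)) : Prop where
  measurable_innovation : ∀ t, Measurable (Z t)
  indep : iIndepFun Z P
  identDistrib : ∀ t, IdentDistrib (Z t) (Z 0) P P
  memLp_two : MemLp (Z 0) 2 P
  centered : ∫ ω, Z 0 ω ∂P = 0
  summable_norm : Summable fun j => ‖Matrix.toEuclideanCLM (𝕜 := ℝ) (A j)‖
  eq_series : ∀ t, 1 ≤ t →
    X t =ᵐ[P] fun ω => ∑' j : ℕ, Matrix.toEuclideanCLM (𝕜 := ℝ) (A j) (Z ((t : ℤ) - (j : ℤ)) ω)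

/-- The normalized lag-`h` cross-product `(1/n) ∑_{t=1}^n a_{t,m} a_{t+h,l}` of the weights;
`a n t m` is the weight of channel `m` at time `t` in the `n`-th row. -/
noncomputable def weightCross {M : ℕ} (a : ℕ → ℤ → Fin M → ℝ) (m l : Fin M) (h : ℤ) (n : ℕ) : ℝ :=
  (1 / (n : ℝ)) * ∑ t ∈ Finset.Icc (1 : ℤ) n, a n t m * a n (t + h) l

/-- `max_{1 ≤ t ≤ n} max_m |a_{t,m}|` for the `n`-th row of the weights (`0` if there are none). -/
noncomputable def weightMax {M : ℕ} (a : ℕ → ℤ → Fin M → ℝ) (n : ℕ) : ℝ :=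
  (((Finset.Icc (1 : ℤ) n ×ˢ (Finset.univ : Finset (Fin M))).sup
    fun p => ‖a n p.1 p.2‖₊ : ℝ≥0) : ℝ)

/-- `S_{m,n} = ∑_{t=1}^n a_{t,m} (f_m(X_t) - E f_m(X_t))`. -/
noncomputable def weightedSum {Ω : Type*} [MeasurableSpace Ω] (P : Measure Ω) {k M : ℕ}
    (X : ℕ → Ω → EuclideanSpace ℝ (Fin k)) (f : Fin M → EuclideanSpace ℝ (Fin k) → ℝ)
    (a : ℕ → ℤ → Fin M → ℝ) (n : ℕ) (m : Fin M) (ω : Ω) : ℝ :=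
  ∑ t ∈ Finset.Icc 1 n, a n (t : ℤ) m * (f m (X t ω) - ∫ ω', f m (X t ω') ∂P)

/-- The lag-`h` cross-covariance `Cov(f_m(X_1), f_l(X_{1+h}))`, `h ≥ 0`. -/
noncomputable def lagCov {Ω : Type*} [MeasurableSpace Ω] (P : Measure Ω) {k M : ℕ}
    (X : ℕ → Ω → EuclideanSpace ℝ (Fin k)) (f : Fin M → EuclideanSpace ℝ (Fin k) → ℝ)
    (m l : Fin M) (h : ℕ) : ℝ :=
  cov[fun ω => f m (X 1 ω), fun ω => f l (X (1 + h) ω); P]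

/-- The one-sided long-run matrix, with entries
`G_{ml}(0) Cov(f_m(X_1), f_l(X_1)) + 2 ∑_{h ≥ 1} G_{ml}(h) Cov(f_m(X_1), f_l(X_{1+h}))`
(the series is indexed by `h - 1`). In general it is not symmetric. -/
noncomputable def longRunMatrix {Ω : Type*} [MeasurableSpace Ω] (P : Measure Ω) {k M : ℕ}
    (X : ℕ → Ω → EuclideanSpace ℝ (Fin k)) (f : Fin M → EuclideanSpace ℝ (Fin k) → ℝ)
    (G : Fin M → Fin M → ℤ → ℝ) : Matrix (Fin M) (Fin M) ℝ :=
  Matrix.of fun m l => G m l 0 * lagCov P X f m l 0 +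
    2 * ∑' h : ℕ, G m l ((h : ℤ) + 1) * lagCov P X f m l (h + 1)

/-- The limiting covariance matrix: the symmetric part of the one-sided long-run matrix, i.e. the
symmetric matrix with the same quadratic form. -/
noncomputable def limitCov {Ω : Type*} [MeasurableSpace Ω] (P : Measure Ω) {k M : ℕ}
    (X : ℕ → Ω → EuclideanSpace ℝ (Fin k)) (f : Fin M → EuclideanSpace ℝ (Fin k) → ℝ)
    (G : Fin M → Fin M → ℤ → ℝ) : Matrix (Fin M) (Fin M) ℝ :=
  (1 / 2 : ℝ) • (longRunMatrix P X f G + (longRunMatrix P X f G).transpose)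

/-! On the space of innovation sequences with its product law, $f_m(\mathbf X_t)$ is one fixed
functional composed with the shift by $t$. The theorem is proved there and then pulled back along
the innovations.

Dependence is measured by influences, the $L^2$ effect of replacing one coordinate by an independent
copy. Resampling coordinates one at a time bounds a covariance by half the sum of the products of
influences (`abs_covariance_le_sum_influence`). For the truncated observables the influence of
innovation $i$ at time $t$ is at most a constant times $\|A_{t-i}\|$, whatever the truncation level
(`influence_obsTrunc_le`). Hence lag-$h$ covariances are dominated by $\sum_i\|A_i\|\|A_{i+h}\|$,
which is summable in $h$, and the variance of a sum with weights $c_t$ is at most a constant times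
$\sum c_t^2$ (`variance_weighted_sum_le`).

The limit theorem is first proved after cutting the series at $q$ terms and clamping the observable
to $[-q,q]$. The summands $\xi_t$ of $S$ are then bounded and depend on $q$ consecutive innovations,
so $\xi_t$ is independent of all summands at distance at least $q$. By the Stein–Tikhomirov method,
$\varphi(u)=\mathbb E e^{iuS}$ nearly solves $\varphi'=-u\,\mathbb E[S^2]\,\varphi$
(`norm_integral_exp_sum_sub_exp_variance_le`). (W2) makes the error vanish, and (W1) gives the limit
of $\mathbb E[S^2]$, a finite sum over lags.

The truncation is removed in $L^2$ uniformly in $n$ (`eventually_lpNorm_weighted_sum_le`): (W1) at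
lag $0$ bounds the normalized $\ell^2$ norm of the weights, and the limiting variances converge by
dominated convergence over lags. Both $G$ and the covariances satisfy
$\Gamma_{m\ell}(-h)=\Gamma_{\ell m}(h)$, so the two-sided series over $h\in\mathbb Z$ is
$\tfrac12(L_{m\ell}+L_{\ell m})$ (`limitCov_apply`). Lévy's continuity theorem concludes. -/

/-! ### Real-valued $L^2$ norms and Cauchy–Schwarz. -/

section L2

variable {Ω Ω' : Type*} [MeasurableSpace Ω] [MeasurableSpace Ω'] {P : Measure Ω} {Q : Measure Ω'}

theorem MeasureTheory.MeasurePreserving.integral_comp_of_aestronglyMeasurable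
    {F : Type*} [NormedAddCommGroup F] [NormedSpace ℝ F] {T : Ω → Ω'} (hT : MeasurePreserving T P Q)
    {f : Ω' → F} (hf : AEStronglyMeasurable f Q) : ∫ x, f (T x) ∂P = ∫ y, f y ∂Q := by
  rw [← hT.map_eq] at hf ⊢
  exact (integral_map hT.measurable.aemeasurable hf).symm

theorem MeasureTheory.MeasurePreserving.lpNorm_comp {F : Type*} [NormedAddCommGroup F] {T : Ω → Ω'}
    (hT : MeasurePreserving T P Q) {f : Ω' → F} (hf : AEStronglyMeasurable f Q) (p : ENNReal) :
    lpNorm (fun x => f (T x)) p P = lpNorm f p Q := by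
  rw [← toReal_eLpNorm hf]
  refine (toReal_eLpNorm (hf.comp_measurePreserving hT)).symm.trans ?_
  congr 1
  exact eLpNorm_comp_measurePreserving hf hT

theorem MeasureTheory.MemLp.integral_sq_eq_lpNorm_sq {f : Ω → ℝ} (hf : MemLp f 2 P) :
    ∫ x, f x ^ 2 ∂P = lpNorm f 2 P ^ 2 := by
  rw [lpNorm_eq_integral_norm_rpow_toReal (by norm_num) (by norm_num) hf.aestronglyMeasurable]
  have h0 : 0 ≤ ∫ x, ‖f x‖ ^ (2 : ENNReal).toReal ∂P := integral_nonneg fun x => by positivity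
  rw [← Real.rpow_natCast, ← Real.rpow_mul h0]
  simp

theorem abs_integral_mul_le_lpNorm_mul_lpNorm {f g : Ω → ℝ} (hf : MemLp f 2 P) (hg : MemLp g 2 P) :
    |∫ x, f x * g x ∂P| ≤ lpNorm f 2 P * lpNorm g 2 P := by
  calc |∫ x, f x * g x ∂P| ≤ ∫ x, |f x * g x| ∂P := abs_integral_le_integral_abs
    _ = ∫ x, ‖f x‖ * ‖g x‖ ∂P := by simp [abs_mul]
    _ ≤ _ := by
      have := integral_mul_norm_le_Lp_mul_Lq (p := 2) (q := 2) (μ := P) (f := f) (g := g)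
        ⟨by norm_num, by norm_num, by norm_num⟩ (by simpa using hf) (by simpa using hg)
      rw [lpNorm_eq_integral_norm_rpow_toReal (by norm_num) (by norm_num) hf.aestronglyMeasurable,
        lpNorm_eq_integral_norm_rpow_toReal (by norm_num) (by norm_num) hg.aestronglyMeasurable]
      simpa using this

theorem integral_abs_le_lpNorm_two [IsProbabilityMeasure P] {f : Ω → ℝ} (hf : MemLp f 2 P) :
    ∫ x, |f x| ∂P ≤ lpNorm f 2 P := by
  have h := abs_integral_mul_le_lpNorm_mul_lpNorm hf.abs (memLp_const (1 : ℝ))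
  rw [lpNorm_const' (by norm_num) (by norm_num)] at h
  have h1 : lpNorm |f| 2 P = lpNorm f 2 P := lpNorm_abs hf.aestronglyMeasurable 2
  rw [h1] at h
  simp at h
  exact (le_abs_self _).trans h

theorem lpNorm_const_mul (c : ℝ) (f : Ω → ℝ) :
    lpNorm (fun x => c * f x) 2 P = |c| * lpNorm f 2 P :=
  lpNorm_const_smul c f P

theorem lpNorm_mono_of_norm_le {F : Type*} [NormedAddCommGroup F] {f : Ω → F} {g : Ω → ℝ}
    (hg : MemLp g 2 P) (h : ∀ x, ‖f x‖ ≤ g x) : lpNorm f 2 P ≤ lpNorm g 2 P :=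
  lpNorm_mono_real hg h

end L2

/-! ### Resampling coordinates of an i.i.d. family; covariance and influence. -/

section Resampling

variable {κ : Type*} {E : Type*} [MeasurableSpace E]

/-- The joint law of an i.i.d. family indexed by `κ` with marginal `μ`. -/
noncomputable abbrev iidLaw (κ : Type*) (μ : Measure E) : Measure (κ → E) :=
  Measure.infinitePi fun _ : κ => μ

theorem measurePreserving_reindex {κ' : Type*} (μ : Measure E) [IsProbabilityMeasure μ]
    {e : κ → κ'} (he : Function.Injective e) :
    MeasurePreserving (fun (w : κ' → E) k => w (e k)) (iidLaw κ' μ) (iidLaw κ μ) :=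
  ⟨by fun_prop, Measure.map_infinitePi_infinitePi_of_inj he⟩

/-- The time shift of a two-sided sequence. -/
def timeShift {E : Type*} (t : ℤ) (z : ℤ → E) : ℤ → E := fun i => z (i + t)

theorem timeShift_zero {E : Type*} (z : ℤ → E) : timeShift 0 z = z := by
  ext i
  simp [timeShift]

theorem timeShift_timeShift {E : Type*} (s t : ℤ) (z : ℤ → E) :
    timeShift s (timeShift t z) = timeShift (s + t) z := by
  ext i
  simp [timeShift, add_assoc]

theorem measurable_timeShift (t : ℤ) : Measurable (timeShift (E := E) t) := by
  unfold timeShift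
  fun_prop

theorem measurePreserving_timeShift (μ : Measure E) [IsProbabilityMeasure μ] (t : ℤ) :
    MeasurePreserving (timeShift (E := E) t) (iidLaw ℤ μ) (iidLaw ℤ μ) :=
  measurePreserving_reindex μ (add_left_injective t)

theorem measurePreserving_coord (μ : Measure E) [IsProbabilityMeasure μ] (i : κ) :
    MeasurePreserving (fun z : κ → E => z i) (iidLaw κ μ) μ :=
  ⟨measurable_pi_apply i, Measure.infinitePi_map_eval (fun _ : κ => μ) i⟩

open Classical in
/-- The index map that reads the coordinates in `J` from the second copy and the others from the
first copy. -/
noncomputable def hybrid (J : Set κ) (k : κ) : κ ⊕ κ := if k ∈ J then Sum.inr k else Sum.inl k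

open Classical in
/-- The permutation of `κ ⊕ κ` that exchanges the two copies of every index in `J`. -/
noncomputable def exchange (J : Set κ) : κ ⊕ κ → κ ⊕ κ :=
  Sum.elim (fun k => if k ∈ J then Sum.inr k else Sum.inl k)
    fun k => if k ∈ J then Sum.inl k else Sum.inr k

theorem exchange_involutive (J : Set κ) : Function.Involutive (exchange J) := by
  rintro (k | k) <;> by_cases h : k ∈ J <;> simp [exchange, h]

theorem hybrid_injective (J : Set κ) : Function.Injective (hybrid J) := by
  intro a b h
  unfold hybrid at h
  split_ifs at h <;> simpa using h

theorem exchange_inl (J : Set κ) (k : κ) : exchange J (Sum.inl k) = hybrid J k := rfl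

/-- Together with `exchange_inl`, this carries the pair (original, $i$ resampled) to the pair ($J$
resampled, $J\cup\{i\}$ resampled). As the permutation preserves the law, both increments of a
functional have the same $L^2$ norm. -/
theorem exchange_hybrid_of_notMem {J : Set κ} {i : κ} (hi : i ∉ J) (k : κ) :
    exchange J (hybrid {i} k) = hybrid (insert i J) k := by
  by_cases h : k = i
  · subst h; simp [exchange, hybrid, hi]
  · by_cases h' : k ∈ J <;> simp [exchange, hybrid, h, h']

theorem exchange_singleton_hybrid {J : Set κ} {i : κ} (hi : i ∉ J) (k : κ) :
    exchange {i} (hybrid J k) = hybrid (insert i J) k := by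
  by_cases h : k = i
  · subst h; simp [exchange, hybrid, hi]
  · by_cases h' : k ∈ J <;> simp [exchange, hybrid, h, h']

/-- The `L²` size of the change of `F` when the coordinate `i` is replaced by an independent
copy. -/
noncomputable def influence (μ : Measure E) (F : (κ → E) → ℝ) (i : κ) : ℝ :=
  lpNorm (fun w : κ ⊕ κ → E => F (fun k => w (Sum.inl k)) - F (fun k => w (hybrid {i} k))) 2
    (iidLaw (κ ⊕ κ) μ)

theorem influence_nonneg (μ : Measure E) (F : (κ → E) → ℝ) (i : κ) : 0 ≤ influence μ F i :=
  lpNorm_nonneg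

variable {μ : Measure E} [IsProbabilityMeasure μ]

/-- Exchanging the two copies of coordinate $i$ preserves the law and reverses the sign of the
increment of $G$. Half the expectation can therefore be rewritten with $F$ replaced by minus its
$i$-resampled version. This produces $F-F^{(i)}$ and the factor $1/2$, and Cauchy–Schwarz finishes.
-/
theorem abs_integral_mul_sub_resample_le {F G : (κ → E) → ℝ} (hF : MemLp F 2 (iidLaw κ μ))
    (hG : MemLp G 2 (iidLaw κ μ)) {J : Set κ} {i : κ} (hi : i ∉ J) :
    |∫ w, F (fun k => w (Sum.inl k)) *
        (G (fun k => w (hybrid J k)) - G (fun k => w (hybrid (insert i J) k)))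
        ∂(iidLaw (κ ⊕ κ) μ)| ≤ (influence μ F i * influence μ G i) / 2 := by
  have hF' (e : κ → κ ⊕ κ) (he : Function.Injective e) :
      MemLp (fun w : κ ⊕ κ → E => F (fun k => w (e k))) 2 (iidLaw (κ ⊕ κ) μ) :=
    hF.comp_measurePreserving (measurePreserving_reindex μ he)
  have hG' (e : κ → κ ⊕ κ) (he : Function.Injective e) :
      MemLp (fun w : κ ⊕ κ → E => G (fun k => w (e k))) 2 (iidLaw (κ ⊕ κ) μ) :=
    hG.comp_measurePreserving (measurePreserving_reindex μ he)
  have hu := hF' Sum.inl Sum.inl_injective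
  have hu' := hF' _ (hybrid_injective {i})
  have hv := (hG' _ (hybrid_injective J)).sub (hG' _ (hybrid_injective (insert i J)))
  have hswap := (measurePreserving_reindex (E := E) μ
    (exchange_involutive ({i} : Set κ)).injective).integral_comp_of_aestronglyMeasurable
    (hu.integrable_mul hv).aestronglyMeasurable
  have hex (k : κ) : exchange {i} (hybrid (insert i J) k) = hybrid J k := by
    rw [← exchange_singleton_hybrid hi, exchange_involutive]
  simp only [Pi.mul_apply, Pi.sub_apply, exchange_inl, exchange_singleton_hybrid hi, hex] at hswap
  -- The increment of $G$ from $J$ to $J\cup\{i\}$ has norm equal to the influence of $i$, whatever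
  -- has already been resampled.
  have hlp := (measurePreserving_reindex (E := E) μ
    (exchange_involutive J).injective).lpNorm_comp
    (f := fun w : κ ⊕ κ → E => G (fun k => w (Sum.inl k)) - G (fun k => w (hybrid {i} k)))
    ((hG' Sum.inl Sum.inl_injective).sub
      (hG' _ (hybrid_injective {i}))).aestronglyMeasurable 2
  simp only [exchange_inl, exchange_hybrid_of_notMem hi] at hlp
  have hcs := abs_integral_mul_le_lpNorm_mul_lpNorm (hu.sub hu') hv
  simp only [Pi.sub_apply] at hcs
  have hsplit : ∫ w, (F (fun k => w (Sum.inl k)) - F (fun k => w (hybrid {i} k))) *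
        (G (fun k => w (hybrid J k)) - G (fun k => w (hybrid (insert i J) k)))
        ∂(iidLaw (κ ⊕ κ) μ) = 2 * ∫ w, F (fun k => w (Sum.inl k)) *
        (G (fun k => w (hybrid J k)) - G (fun k => w (hybrid (insert i J) k)))
        ∂(iidLaw (κ ⊕ κ) μ) := by
    have hsub := integral_sub (hu.integrable_mul hv) (hu'.integrable_mul hv)
    simp only [Pi.mul_apply, Pi.sub_apply] at hsub
    simp only [sub_mul]
    rw [hsub, two_mul]
    nth_rw 3 [← hswap]
    rw [sub_eq_add_neg, ← integral_neg]
    congr 2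
    ext w
    ring
  rw [hsplit, abs_mul, abs_two] at hcs
  have : lpNorm ((fun w : κ ⊕ κ → E => G fun k => w (hybrid J k)) -
      fun w => G fun k => w (hybrid (insert i J) k)) 2 (iidLaw (κ ⊕ κ) μ) = influence μ G i := hlp
  rw [this] at hcs
  change _ ≤ influence μ F i * _ at hcs
  linarith

/-- Telescoping: the coordinates of $J$ are resampled one after the other, each at the cost given by
`abs_integral_mul_sub_resample_le`. -/
theorem abs_integral_mul_sub_hybrid_le {F G : (κ → E) → ℝ} (hF : MemLp F 2 (iidLaw κ μ))
    (hG : MemLp G 2 (iidLaw κ μ)) (J : Finset κ) :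
    |∫ w, F (fun k => w (Sum.inl k)) *
        (G (fun k => w (Sum.inl k)) - G (fun k => w (hybrid (J : Set κ) k)))
        ∂(iidLaw (κ ⊕ κ) μ)| ≤ (∑ i ∈ J, influence μ F i * influence μ G i) / 2 := by
  classical
  have hF' (e : κ → κ ⊕ κ) (he : Function.Injective e) :
      MemLp (fun w : κ ⊕ κ → E => F (fun k => w (e k))) 2 (iidLaw (κ ⊕ κ) μ) :=
    hF.comp_measurePreserving (measurePreserving_reindex μ he)
  have hG' (e : κ → κ ⊕ κ) (he : Function.Injective e) :
      MemLp (fun w : κ ⊕ κ → E => G (fun k => w (e k))) 2 (iidLaw (κ ⊕ κ) μ) :=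
    hG.comp_measurePreserving (measurePreserving_reindex μ he)
  induction J using Finset.induction_on with
  | empty => simp [hybrid]
  | insert i J hi ih =>
    have hu := hF' Sum.inl Sum.inl_injective
    have h1 := hu.integrable_mul
      ((hG' Sum.inl Sum.inl_injective).sub (hG' _ (hybrid_injective (J : Set κ))))
    have h2 := hu.integrable_mul
      ((hG' _ (hybrid_injective (J : Set κ))).sub (hG' _ (hybrid_injective (insert i J : Set κ))))
    have h3 := abs_integral_mul_sub_resample_le hF hG (J := (J : Set κ)) (i := i) (by simpa)
    have hadd : ∫ w, F (fun k => w (Sum.inl k)) *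
        (G (fun k => w (Sum.inl k)) - G (fun k => w (hybrid (insert i J : Set κ) k)))
        ∂(iidLaw (κ ⊕ κ) μ) = (∫ w, F (fun k => w (Sum.inl k)) *
        (G (fun k => w (Sum.inl k)) - G (fun k => w (hybrid (J : Set κ) k))) ∂(iidLaw (κ ⊕ κ) μ)) +
        ∫ w, F (fun k => w (Sum.inl k)) *
        (G (fun k => w (hybrid (J : Set κ) k)) - G (fun k => w (hybrid (insert i J : Set κ) k)))
        ∂(iidLaw (κ ⊕ κ) μ) := by
      have hsum := integral_add h1 h2
      simp only [Pi.mul_apply, Pi.sub_apply] at hsum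
      rw [← hsum]
      congr 1
      ext w
      ring
    rw [Finset.sum_insert hi, Finset.coe_insert, hadd]
    refine (abs_add_le _ _).trans ?_
    linarith

theorem indepFun_inl_inr (μ : Measure E) [IsProbabilityMeasure μ] :
    IndepFun (fun (w : κ ⊕ κ → E) (k : κ) => w (Sum.inl k)) (fun w k => w (Sum.inr k))
      (iidLaw (κ ⊕ κ) μ) := by
  have hind : iIndepFun (fun (i : κ ⊕ κ) (w : κ ⊕ κ → E) => w i) (iidLaw (κ ⊕ κ) μ) :=
    iIndepFun_infinitePi (P := fun _ => μ) (X := fun _ x => x) fun _ => measurable_id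
  have hle (i : κ ⊕ κ) : MeasurableSpace.comap (fun w : κ ⊕ κ → E => w i) inferInstance ≤
      MeasurableSpace.pi := (measurable_pi_apply i).comap_le
  have h := indep_iSup_of_disjoint hle hind
    (S := Set.range Sum.inl) (T := Set.range Sum.inr) Set.isCompl_range_inl_range_inr.disjoint
  have key (S : Set (κ ⊕ κ)) (e : κ → κ ⊕ κ) (he : ∀ k, e k ∈ S) :
      MeasurableSpace.comap (fun (w : κ ⊕ κ → E) (k : κ) => w (e k)) MeasurableSpace.pi ≤
        ⨆ i ∈ S, MeasurableSpace.comap (fun w : κ ⊕ κ → E => w i) inferInstance := by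
    change MeasurableSpace.comap _ (⨆ k : κ, MeasurableSpace.comap (fun b : κ → E => b k) _) ≤ _
    rw [MeasurableSpace.comap_iSup]
    refine iSup_le fun k => ?_
    rw [MeasurableSpace.comap_comp]
    exact le_iSup₂_of_le (e k) (he k) le_rfl
  rw [IndepFun_iff_Indep]
  exact indep_of_indep_of_le h (key _ _ fun k => ⟨k, rfl⟩) (key _ _ fun k => ⟨k, rfl⟩)

/-- A covariance of functions of independent variables is controlled by their influences. -/
theorem abs_covariance_le_sum_influence {F G : (κ → E) → ℝ} (hFm : Measurable F)
    (hGm : Measurable G) (hF : MemLp F 2 (iidLaw κ μ))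
    (hG : MemLp G 2 (iidLaw κ μ)) {I : Finset κ} (hGI : DependsOn G (I : Set κ)) :
    |cov[F, G; iidLaw κ μ]| ≤ (∑ i ∈ I, influence μ F i * influence μ G i) / 2 := by
  have hl := measurePreserving_reindex (E := E) μ (Sum.inl_injective (α := κ) (β := κ))
  have hr := measurePreserving_reindex (E := E) μ (Sum.inr_injective (α := κ) (β := κ))
  have hFl : MemLp (fun w : κ ⊕ κ → E => F (fun k => w (Sum.inl k))) 2 (iidLaw (κ ⊕ κ) μ) :=
    hF.comp_measurePreserving hl
  have hGl : MemLp (fun w : κ ⊕ κ → E => G (fun k => w (Sum.inl k))) 2 (iidLaw (κ ⊕ κ) μ) :=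
    hG.comp_measurePreserving hl
  have hGr : MemLp (fun w : κ ⊕ κ → E => G (fun k => w (Sum.inr k))) 2 (iidLaw (κ ⊕ κ) μ) :=
    hG.comp_measurePreserving hr
  have hind : IndepFun (fun w : κ ⊕ κ → E => F (fun k => w (Sum.inl k)))
      (fun w => G (fun k => w (Sum.inr k))) (iidLaw (κ ⊕ κ) μ) :=
    (indepFun_inl_inr μ).comp hFm hGm
  have h0 := hind.covariance_eq_zero hFl hGr
  rw [covariance_eq_sub hFl hGr] at h0
  -- Once all coordinates in $I$ are resampled, $G$ sees only the second copy and is independent of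
  -- $F$ on the first; the telescoped expectation is then the covariance.
  have hhyb (w : κ ⊕ κ → E) : G (fun k => w (hybrid (I : Set κ) k)) = G (fun k => w (Sum.inr k)) :=
    hGI fun k hk => by simp [hybrid, Finset.mem_coe.1 hk]
  have h := abs_integral_mul_sub_hybrid_le hF hG I
  simp only [hhyb, mul_sub] at h
  have hsub := integral_sub (hFl.integrable_mul hGl) (hFl.integrable_mul hGr)
  simp only [Pi.mul_apply] at hsub
  rw [hsub] at h
  have e1 := hl.integral_comp_of_aestronglyMeasurable (hF.integrable_mul hG).aestronglyMeasurable
  have e2 := hl.integral_comp_of_aestronglyMeasurable hF.aestronglyMeasurable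
  have e3 := hr.integral_comp_of_aestronglyMeasurable hG.aestronglyMeasurable
  simp only [Pi.mul_apply] at e1 h0
  rw [e1] at h
  rw [e2, e3] at h0
  rw [covariance_eq_sub hF hG]
  simp only [Pi.mul_apply]
  rwa [← sub_eq_zero.1 h0]

end Resampling

/-! ### Stein–Tikhomirov estimate for characteristic functions. -/

section CharacteristicFunction

/-- Taylor's estimate for $|x|\le1$; for $|x|\ge1$ the trivial bound $2+|x|\le 3x^2$, which is where
the $3$ comes from. -/
theorem norm_exp_ofReal_mul_I_sub_one_sub_le (x : ℝ) :
    ‖Complex.exp (x * Complex.I) - 1 - x * Complex.I‖ ≤ 3 * x ^ 2 := by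
  have hn : ‖(x : ℂ) * Complex.I‖ = |x| := by simp
  rcases le_total |x| 1 with h | h
  · refine (Complex.norm_exp_sub_one_sub_id_le (by rwa [hn])).trans ?_
    rw [hn, sq_abs]
    nlinarith [sq_nonneg x]
  · calc ‖Complex.exp (x * Complex.I) - 1 - x * Complex.I‖
        ≤ ‖Complex.exp (x * Complex.I)‖ + ‖(1 : ℂ)‖ + ‖(x : ℂ) * Complex.I‖ :=
          (norm_sub_le _ _).trans (add_le_add_left (norm_sub_le _ _) _)
      _ = 2 + |x| := by rw [Complex.norm_exp_ofReal_mul_I, hn]; norm_num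
      _ ≤ 3 * |x| ^ 2 := by nlinarith
      _ = 3 * x ^ 2 := by rw [sq_abs]

variable {Ω : Type*} [MeasurableSpace Ω] {P : Measure Ω} [IsProbabilityMeasure P]

theorem hasDerivAt_integral_exp_mul_I {S : Ω → ℝ} (hS : Measurable S) {C : ℝ}
    (hC : ∀ ω, |S ω| ≤ C) (u : ℝ) :
    HasDerivAt (fun u : ℝ => ∫ ω, Complex.exp ((u * S ω : ℝ) * Complex.I) ∂P)
      (∫ ω, S ω * Complex.I * Complex.exp ((u * S ω : ℝ) * Complex.I) ∂P) u := by
  have hm (u : ℝ) : Measurable fun ω => Complex.exp ((u * S ω : ℝ) * Complex.I) := by fun_prop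
  refine (hasDerivAt_integral_of_dominated_loc_of_deriv_le (s := Set.univ) (bound := fun _ => C)
    (F := fun (u : ℝ) ω => Complex.exp ((u * S ω : ℝ) * Complex.I))
    (F' := fun u ω => S ω * Complex.I * Complex.exp ((u * S ω : ℝ) * Complex.I))
    univ_mem (.of_forall fun v => (hm v).aestronglyMeasurable)
    (.of_bound (hm u).aestronglyMeasurable 1 (.of_forall fun ω => ?_))
    (by fun_prop) (.of_forall fun ω v _ => ?_) (integrable_const C)
    (.of_forall fun ω v _ => ?_)).2
  · rw [Complex.norm_exp_ofReal_mul_I]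
  · rw [norm_mul, norm_mul, Complex.norm_exp_ofReal_mul_I]
    simpa using hC ω
  · have h1 : HasDerivAt (fun v : ℝ => ((v * S ω : ℝ) : ℂ) * Complex.I) (S ω * Complex.I) v := by
      have := ((hasDerivAt_id v).mul_const (S ω)).ofReal_comp.mul_const Complex.I
      simpa using this
    simpa [mul_comm] using h1.cexp

/-- If `S = ∑ ξ t` where each centered `ξ t` is independent of `S - W t`, then the characteristic
function of `S` is close to the Gaussian one as soon as `∑ ξ t * W t` is nearly constant. -/
theorem norm_integral_exp_sub_exp_le {ι : Type*} {T : Finset ι} {ξ W : ι → Ω → ℝ} {C s : ℝ}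
    (hs : 0 ≤ s) (hξm : ∀ t ∈ T, Measurable (ξ t)) (hWm : ∀ t ∈ T, Measurable (W t))
    (hξ : ∀ t ∈ T, ∀ ω, |ξ t ω| ≤ C) (hW : ∀ t ∈ T, ∀ ω, |W t ω| ≤ C)
    (h0 : ∀ t ∈ T, ∫ ω, ξ t ω ∂P = 0)
    (hind : ∀ t ∈ T, IndepFun (ξ t) (fun ω => ∑ r ∈ T, ξ r ω - W t ω) P) :
    ‖∫ ω, Complex.exp ((∑ t ∈ T, ξ t ω : ℝ) * Complex.I) ∂P - Real.exp (-s / 2)‖ ≤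
      ∫ ω, |∑ t ∈ T, ξ t ω * W t ω - s| ∂P + 3 * ∑ t ∈ T, ∫ ω, |ξ t ω| * W t ω ^ 2 ∂P := by
  set S : Ω → ℝ := fun ω => ∑ t ∈ T, ξ t ω with hSdef
  have hSm : Measurable S := Finset.measurable_fun_sum _ hξm
  have hSb (ω : Ω) : |S ω| ≤ ∑ t ∈ T, C :=
    (Finset.abs_sum_le_sum_abs _ _).trans (Finset.sum_le_sum fun t ht => hξ t ht ω)
  set V : Ω → ℝ := fun ω => ∑ t ∈ T, ξ t ω * W t ω with hVdef
  have hVm : Measurable V := Finset.measurable_fun_sum _ fun t ht => (hξm t ht).mul (hWm t ht)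
  have hVb (ω : Ω) : |V ω| ≤ ∑ t ∈ T, C * C := by
    refine (Finset.abs_sum_le_sum_abs _ _).trans (Finset.sum_le_sum fun t ht => ?_)
    rw [abs_mul]
    exact mul_le_mul (hξ t ht ω) (hW t ht ω) (abs_nonneg _) ((abs_nonneg _).trans (hξ t ht ω))
  have hb {f : Ω → ℂ} (hf : Measurable f) (c : ℝ) (h : ∀ ω, ‖f ω‖ ≤ c) : Integrable f P :=
    .of_bound hf.aestronglyMeasurable c (.of_forall h)
  have hbr {f : Ω → ℝ} (hf : Measurable f) (c : ℝ) (h : ∀ ω, |f ω| ≤ c) : Integrable f P :=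
    .of_bound hf.aestronglyMeasurable c (.of_forall h)
  set e : ℝ → Ω → ℂ := fun u ω => Complex.exp ((u * S ω : ℝ) * Complex.I) with hedef
  have hem (u : ℝ) : Measurable (e u) := by fun_prop
  have hen (u : ℝ) (ω : Ω) : ‖e u ω‖ = 1 := Complex.norm_exp_ofReal_mul_I _
  set ε := ∫ ω, |V ω - s| ∂P + 3 * ∑ t ∈ T, ∫ ω, |ξ t ω| * W t ω ^ 2 ∂P with hε
  have hVs : Integrable (fun ω => |V ω - s|) P :=
    (hbr (hVm.sub_const s) (∑ t ∈ T, C * C + |s|) fun ω =>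
      (abs_sub _ _).trans (add_le_add_left (hVb ω) _)).abs
  have hξW (t : ι) (ht : t ∈ T) : Integrable (fun ω => |ξ t ω| * W t ω ^ 2) P := by
    refine hbr ((hξm t ht).abs.mul ((hWm t ht).pow_const 2)) (C * C ^ 2) fun ω => ?_
    rw [abs_mul, abs_abs, abs_pow]
    have := hξ t ht ω
    have := hW t ht ω
    gcongr
    exact (abs_nonneg _).trans ‹|ξ t ω| ≤ C›
  -- By independence the expectation factors, and $\xi_t$ is centered.
  have hzero (u : ℝ) (t : ι) (ht : t ∈ T) :
      ∫ ω, (ξ t ω : ℂ) * Complex.exp ((u * (S ω - W t ω) : ℝ) * Complex.I) ∂P = 0 := by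
    have h := (hind t ht).integral_fun_comp_mul_comp (𝕜 := ℂ) (f := fun x : ℝ => (x : ℂ))
      (g := fun x : ℝ => Complex.exp ((u * x : ℝ) * Complex.I)) (hξm t ht).aemeasurable
      (hSm.sub (hWm t ht)).aemeasurable (by fun_prop) (by fun_prop)
    rwa [integral_complex_ofReal, h0 t ht, Complex.ofReal_zero, zero_mul] at h
  -- The approximate equation $\varphi'(u)=-us\,\varphi(u)$. Subtracting the null terms of `hzero`
  -- turns $\xi_te^{iuS}$ into $\xi_t(e^{iuS}-e^{iu(S-W_t)})$. Its first-order part is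
  -- $iu\,\xi_tW_te^{iuS}$, and these sum to $iuVe^{iuS}$; the rest is quadratic in $W_t$.
  have hkey (u : ℝ) (hu : u ∈ Set.Icc (0 : ℝ) 1) :
      ‖∫ ω, S ω * Complex.I * e u ω ∂P + (u * s : ℝ) * ∫ ω, e u ω ∂P‖ ≤ ε := by
    have i1 : Integrable (fun ω => (S ω : ℂ) * Complex.I * e u ω) P :=
      hb (by fun_prop) (∑ t ∈ T, C) fun ω => by simpa [hen] using hSb ω
    have i2 : Integrable (fun ω => ((u * s : ℝ) : ℂ) * e u ω) P :=
      (hb (hem u) 1 fun ω => (hen u ω).le).const_mul _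
    have i3 (t : ι) (ht : t ∈ T) : Integrable (fun ω => (ξ t ω : ℂ) *
        Complex.exp ((u * (S ω - W t ω) : ℝ) * Complex.I)) P := by
      have := hξm t ht
      have := hWm t ht
      refine hb (by fun_prop) C fun ω => ?_
      rw [norm_mul, Complex.norm_exp_ofReal_mul_I]
      simpa using hξ t ht ω
    have heq : ∫ ω, S ω * Complex.I * e u ω ∂P + (u * s : ℝ) * ∫ ω, e u ω ∂P =
        ∫ ω, (S ω * Complex.I * e u ω + (u * s : ℝ) * e u ω - ∑ t ∈ T, Complex.I * ((ξ t ω : ℂ) *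
          Complex.exp ((u * (S ω - W t ω) : ℝ) * Complex.I))) ∂P := by
      have hz : ∫ ω, ∑ t ∈ T, Complex.I * ((ξ t ω : ℂ) *
          Complex.exp ((u * (S ω - W t ω) : ℝ) * Complex.I)) ∂P = 0 := by
        rw [integral_finsetSum _ fun t ht => (i3 t ht).const_mul _]
        refine Finset.sum_eq_zero fun t ht => ?_
        rw [integral_const_mul, hzero u t ht, mul_zero]
      have hsub := integral_sub (i1.add i2)
        (integrable_finsetSum T fun t ht => (i3 t ht).const_mul Complex.I)
      simp only [Pi.add_apply] at hsub
      rw [hsub, hz, sub_zero, integral_add i1 i2, integral_const_mul]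
    have hpt (ω : Ω) : ‖S ω * Complex.I * e u ω + (u * s : ℝ) * e u ω -
        ∑ t ∈ T, Complex.I * ((ξ t ω : ℂ) *
          Complex.exp ((u * (S ω - W t ω) : ℝ) * Complex.I))‖ ≤
        |V ω - s| + 3 * ∑ t ∈ T, |ξ t ω| * W t ω ^ 2 := by
      have hfac : S ω * Complex.I * e u ω + (u * s : ℝ) * e u ω -
        ∑ t ∈ T, Complex.I * ((ξ t ω : ℂ) *
          Complex.exp ((u * (S ω - W t ω) : ℝ) * Complex.I)) =
          -(u * (V ω - s) : ℝ) * e u ω - ∑ t ∈ T, (ξ t ω : ℂ) * Complex.I * e u ω *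
            (Complex.exp ((-(u * W t ω) : ℝ) * Complex.I) - 1 -
              (-(u * W t ω) : ℝ) * Complex.I) := by
        have h1 (t : ι) : Complex.exp ((u * (S ω - W t ω) : ℝ) * Complex.I) =
            e u ω * Complex.exp ((-(u * W t ω) : ℝ) * Complex.I) := by
          rw [hedef, ← Complex.exp_add]
          congr 1
          push_cast
          ring
        simp only [h1]
        generalize e u ω = x
        simp only [hSdef, hVdef]
        push_cast
        rw [Finset.sum_mul, Finset.sum_mul]
        have h2 (a : ℂ) : -(↑u * (∑ t ∈ T, (ξ t ω : ℂ) * (W t ω : ℂ) - s)) * a =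
            ∑ t ∈ T, -(u * (ξ t ω * W t ω)) * a + u * s * a := by
          rw [← Finset.sum_mul, Finset.sum_neg_distrib, ← Finset.mul_sum]
          ring
        rw [h2, add_sub_right_comm, add_sub_right_comm, ← Finset.sum_sub_distrib,
          ← Finset.sum_sub_distrib]
        congr 1
        refine Finset.sum_congr rfl fun t _ => ?_
        linear_combination (u * (ξ t ω * W t ω) * x) * Complex.I_sq
      rw [hfac]
      refine (norm_sub_le _ _).trans (add_le_add ?_ ?_)
      · rw [norm_mul, hen, mul_one, norm_neg, Complex.norm_real, Real.norm_eq_abs, abs_mul,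
          abs_of_nonneg hu.1]
        exact mul_le_of_le_one_left (abs_nonneg _) hu.2
      · refine (norm_sum_le _ _).trans ?_
        rw [Finset.mul_sum]
        refine Finset.sum_le_sum fun t _ => ?_
        rw [norm_mul, norm_mul, norm_mul, hen, Complex.norm_I, mul_one, mul_one,
          Complex.norm_real, Real.norm_eq_abs]
        have h1 := norm_exp_ofReal_mul_I_sub_one_sub_le (-(u * W t ω))
        have h2 : (-(u * W t ω)) ^ 2 ≤ W t ω ^ 2 := by
          rw [neg_sq, mul_pow]
          exact mul_le_of_le_one_left (sq_nonneg _) (pow_le_one₀ hu.1 hu.2)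
        calc _ ≤ |ξ t ω| * (3 * W t ω ^ 2) :=
              mul_le_mul_of_nonneg_left (h1.trans (by linarith)) (abs_nonneg _)
          _ = _ := by ring
    rw [heq]
    refine (norm_integral_le_of_norm_le (hVs.add
      ((integrable_finsetSum _ fun t ht => hξW t ht).const_mul 3)) (.of_forall hpt)).trans_eq ?_
    have hsum := integral_add hVs ((integrable_finsetSum T fun t ht => hξW t ht).const_mul 3)
    rw [integral_const_mul, integral_finsetSum _ fun t ht => hξW t ht] at hsum
    exact hsum
  have hε0 : 0 ≤ ε := (norm_nonneg _).trans (hkey 0 (by simp))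
  -- Integrating factor: the derivative of $g$ is only the error in `hkey` times the exponential,
  -- and $g(1)-g(0)$ is the wanted difference times $e^{s/2}$.
  set g : ℝ → ℂ := fun u => (∫ ω, e u ω ∂P) * (Real.exp (u ^ 2 * s / 2) : ℂ) with hg
  have hderiv (u : ℝ) : HasDerivAt g ((∫ ω, S ω * Complex.I * e u ω ∂P +
      (u * s : ℝ) * ∫ ω, e u ω ∂P) * (Real.exp (u ^ 2 * s / 2) : ℂ)) u := by
    have h1 := hasDerivAt_integral_exp_mul_I (P := P) hSm hSb u
    have h2 : HasDerivAt (fun u : ℝ => Real.exp (u ^ 2 * s / 2))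
        (Real.exp (u ^ 2 * s / 2) * (u * s)) u := by
      have h3 : HasDerivAt (fun u : ℝ => u ^ 2 * s / 2) (u * s) u := by
        refine (((hasDerivAt_pow 2 u).mul_const s).div_const 2).congr_deriv ?_
        norm_num
        ring
      exact h3.exp
    refine (h1.mul h2.ofReal_comp).congr_deriv ?_
    rw [add_mul, Complex.ofReal_mul (Real.exp _)]
    congr 1
    ring
  have hmv := norm_image_sub_le_of_norm_deriv_le_segment_01' (f := g)
    (C := ε * Real.exp (s / 2)) (fun u _ => (hderiv u).hasDerivWithinAt) fun u hu => by
      rw [norm_mul, Complex.norm_real, Real.norm_eq_abs, Real.abs_exp]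
      refine mul_le_mul (hkey u ⟨hu.1, hu.2.le⟩) (Real.exp_le_exp.2 ?_) (Real.exp_pos _).le hε0
      have : u ^ 2 ≤ 1 := pow_le_one₀ hu.1 hu.2.le
      nlinarith
  have hg0 : g 0 = 1 := by simp [hg, hedef]
  have hg1 : g 1 - g 0 = (∫ ω, Complex.exp ((S ω : ℝ) * Complex.I) ∂P - Real.exp (-s / 2)) *
      (Real.exp (s / 2) : ℂ) := by
    rw [hg0, sub_mul, ← Complex.ofReal_mul, ← Real.exp_add, hg]
    simp only [hedef]
    rw [show -s / 2 + s / 2 = 0 by ring]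
    simp
  rw [hg1, norm_mul, Complex.norm_real, Real.norm_eq_abs, Real.abs_exp] at hmv
  exact le_of_mul_le_mul_right hmv (Real.exp_pos _)

end CharacteristicFunction

/-! ### Gaussian approximation for bounded summands of finite range. -/

section FiniteRangeDependence

theorem card_filter_abs_sub_lt_le (T : Finset ℤ) (t : ℤ) (r : ℕ) :
    ((T.filter fun s => |s - t| < r).card : ℝ) ≤ 2 * r := by
  have hsub : (T.filter fun s => |s - t| < r) ⊆ Finset.Ioo (t - r) (t + r) := by
    intro s hs
    have := abs_lt.1 (Finset.mem_filter.1 hs).2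
    rw [Finset.mem_Ioo]
    omega
  have h := Finset.card_le_card hsub
  rw [Int.card_Ioo] at h
  have h2 : (T.filter fun s => |s - t| < r).card ≤ 2 * r := by omega
  exact_mod_cast h2

/-- $\beta_t\beta_s\le(\beta_t^2+\beta_s^2)/2$; by symmetry of the band both squares contribute
equally, and each row has at most $2r$ entries. -/
theorem sum_sum_mul_le_of_abs_sub_lt (T : Finset ℤ) (β : ℤ → ℝ) (r : ℕ) :
    ∑ t ∈ T, ∑ s ∈ T with |s - t| < r, β t * β s ≤ 2 * r * ∑ t ∈ T, β t ^ 2 := by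
  have hsymm : ∑ t ∈ T, ∑ s ∈ T with |s - t| < r, β s ^ 2 =
      ∑ t ∈ T, ∑ s ∈ T with |s - t| < r, β t ^ 2 := by
    simp only [Finset.sum_filter]
    rw [Finset.sum_comm]
    simp only [abs_sub_comm]
  have hcard : ∑ t ∈ T, ∑ s ∈ T with |s - t| < r, β t ^ 2 ≤ 2 * r * ∑ t ∈ T, β t ^ 2 := by
    rw [Finset.mul_sum]
    refine Finset.sum_le_sum fun t _ => ?_
    rw [Finset.sum_const, nsmul_eq_mul]
    exact mul_le_mul_of_nonneg_right (card_filter_abs_sub_lt_le T t r) (sq_nonneg _)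
  calc ∑ t ∈ T, ∑ s ∈ T with |s - t| < r, β t * β s
      ≤ ∑ t ∈ T, ∑ s ∈ T with |s - t| < r, (β t ^ 2 + β s ^ 2) / 2 :=
        Finset.sum_le_sum fun t _ => Finset.sum_le_sum fun s _ => by
          nlinarith [sq_nonneg (β t - β s)]
    _ = (∑ t ∈ T, ∑ s ∈ T with |s - t| < r, β t ^ 2 +
        ∑ t ∈ T, ∑ s ∈ T with |s - t| < r, β s ^ 2) / 2 := by
        simp only [← Finset.sum_div, Finset.sum_add_distrib]
    _ ≤ _ := by rw [hsymm]; linarith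

variable {Ω : Type*} {mΩ : MeasurableSpace Ω} {P : Measure Ω}

theorem indepFun_of_measurable_iSup {ι β γ : Type*} [MeasurableSpace β] [MeasurableSpace γ]
    {m : ι → MeasurableSpace Ω} (hle : ∀ i, m i ≤ mΩ) (hind : iIndep m P) {A B : Set ι}
    (hAB : Disjoint A B) {f : Ω → β} {g : Ω → γ} (hf : Measurable[⨆ i ∈ A, m i] f)
    (hg : Measurable[⨆ i ∈ B, m i] g) : IndepFun f g P := by
  rw [IndepFun_iff_Indep]
  exact indep_of_indep_of_le (indep_iSup_of_disjoint hle hind hAB) hf.comap_le hg.comap_le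

variable [IsProbabilityMeasure P]

theorem abs_covariance_le_of_abs_le {f g : Ω → ℝ} {c d : ℝ}
    (hf : ∀ ω, |f ω| ≤ c) (hg : ∀ ω, |g ω| ≤ d) : |cov[f, g; P]| ≤ 4 * (c * d) := by
  have hmean {f : Ω → ℝ} {c : ℝ} (hf : ∀ ω, |f ω| ≤ c) (ω : Ω) : |f ω - ∫ x, f x ∂P| ≤ 2 * c := by
    have h1 : |∫ x, f x ∂P| ≤ c := by
      simpa using norm_integral_le_of_norm_le_const (μ := P) (f := f) (.of_forall hf)
    have h2 := abs_sub (f ω) (∫ x, f x ∂P)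
    linarith [hf ω]
  have h := norm_integral_le_of_norm_le_const (μ := P) (C := 4 * (c * d))
    (f := fun ω => (f ω - ∫ x, f x ∂P) * (g ω - ∫ x, g x ∂P)) (.of_forall fun ω => by
      rw [Real.norm_eq_abs, abs_mul]
      calc _ ≤ (2 * c) * (2 * d) := mul_le_mul (hmean hf ω) (hmean hg ω) (abs_nonneg _)
            ((abs_nonneg _).trans (hmean hf ω))
        _ = _ := by ring)
  simpa [covariance] using h

/-- A Gaussian approximation of the characteristic function of a sum of bounded centered random
variables, each of which depends on the `q` last members of an independent sequence. -/
theorem norm_integral_exp_sum_sub_exp_variance_le {m : ℤ → MeasurableSpace Ω}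
    (hle : ∀ i, m i ≤ mΩ) (hind : iIndep m P) {q : ℕ} {T : Finset ℤ} {ξ : ℤ → Ω → ℝ}
    {β : ℤ → ℝ} {b : ℝ} (hb0 : 0 ≤ b)
    (hm : ∀ t ∈ T, Measurable[⨆ i ∈ Set.Ioc (t - q) t, m i] (ξ t))
    (hξ : ∀ t ∈ T, ∀ ω, |ξ t ω| ≤ β t) (hβ : ∀ t ∈ T, β t ≤ b)
    (h0 : ∀ t ∈ T, ∫ ω, ξ t ω ∂P = 0) :
    ‖∫ ω, Complex.exp ((∑ t ∈ T, ξ t ω : ℝ) * Complex.I) ∂P -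
        Real.exp (-(∫ ω, (∑ t ∈ T, ξ t ω) ^ 2 ∂P) / 2)‖ ≤
      √(96 * q ^ 3 * b ^ 2 * ∑ t ∈ T, β t ^ 2) + 12 * q ^ 2 * b * ∑ t ∈ T, β t ^ 2 := by
  have hF (A : Set ℤ) : ⨆ i ∈ A, m i ≤ mΩ := iSup₂_le fun i _ => hle i
  have hmono {A B : Set ℤ} (h : A ⊆ B) : ⨆ i ∈ A, m i ≤ ⨆ i ∈ B, m i := biSup_mono h
  obtain ⟨ω₀⟩ : Nonempty Ω := nonempty_of_isProbabilityMeasure P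
  have hβ0 (t : ℤ) (ht : t ∈ T) : 0 ≤ β t := (abs_nonneg _).trans (hξ t ht ω₀)
  set near : ℤ → Finset ℤ := fun t => T.filter fun s => |s - t| < q with hnear
  set W : ℤ → Ω → ℝ := fun t ω => ∑ s ∈ near t, ξ s ω with hWdef
  set Q := ∑ t ∈ T, β t ^ 2 with hQ
  have hξm (t : ℤ) (ht : t ∈ T) : Measurable (ξ t) := (hm t ht).mono (hF _) le_rfl
  have hWm (t : ℤ) : Measurable (W t) :=
    Finset.measurable_fun_sum _ fun s hs => hξm s (Finset.mem_filter.1 hs).1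
  have hWβ (t : ℤ) (ω : Ω) : |W t ω| ≤ ∑ s ∈ near t, β s :=
    (Finset.abs_sum_le_sum_abs _ _).trans
      (Finset.sum_le_sum fun s hs => hξ s (Finset.mem_filter.1 hs).1 ω)
  have hnearb (t : ℤ) : ∑ s ∈ near t, β s ≤ 2 * q * b := by
    refine (Finset.sum_le_sum fun s hs => hβ s (Finset.mem_filter.1 hs).1).trans ?_
    rw [Finset.sum_const, nsmul_eq_mul]
    exact mul_le_mul_of_nonneg_right (card_filter_abs_sub_lt_le T t q) hb0
  have hnear0 (t : ℤ) : 0 ≤ ∑ s ∈ near t, β s :=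
    Finset.sum_nonneg fun s hs => hβ0 s (Finset.mem_filter.1 hs).1
  have hR (t : ℤ) (ω : Ω) : ∑ r ∈ T, ξ r ω - W t ω = ∑ s ∈ T with ¬ |s - t| < q, ξ s ω := by
    rw [sub_eq_iff_eq_add', hWdef, Finset.sum_filter_add_sum_filter_not]
  -- The summands left after removing $W_t$ have $|s-t|\ge q$, so their windows $(s-q,s]$ miss
  -- $(t-q,t]$.
  have hRind (t : ℤ) (ht : t ∈ T) : IndepFun (ξ t) (fun ω => ∑ r ∈ T, ξ r ω - W t ω) P := by
    refine indepFun_of_measurable_iSup hle hind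
      (disjoint_compl_right (a := Set.Ioc (t - q : ℤ) t)) (hm t ht) ?_
    simp only [hR]
    refine Finset.measurable_fun_sum _ fun s hs => ?_
    have hs' := Finset.mem_filter.1 hs
    refine (hm s hs'.1).mono (hmono fun i hi hi' => hs'.2 ?_) le_rfl
    rw [Set.mem_Ioc] at hi hi'
    rw [abs_lt]
    omega
  have hβT (t : ℤ) (ht : t ∈ T) : β t ≤ ∑ s ∈ T, β s := Finset.single_le_sum hβ0 ht
  have hξb (t : ℤ) (ht : t ∈ T) (ω : Ω) : |ξ t ω| ≤ ∑ s ∈ T, β s := (hξ t ht ω).trans (hβT t ht)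
  have hWb (t : ℤ) (ω : Ω) : |W t ω| ≤ ∑ s ∈ T, β s := (hWβ t ω).trans
    (Finset.sum_le_sum_of_subset_of_nonneg (Finset.filter_subset _ _) fun s hs _ => hβ0 s hs)
  have hmem {f : Ω → ℝ} (hf : Measurable f) (c : ℝ) (h : ∀ ω, |f ω| ≤ c) : MemLp f 2 P :=
    .of_bound hf.aestronglyMeasurable c (.of_forall h)
  have hξ2 (t : ℤ) (ht : t ∈ T) : MemLp (ξ t) 2 P := hmem (hξm t ht) _ (hξ t ht)
  have hW2 (t : ℤ) : MemLp (W t) 2 P := hmem (hWm t) _ (hWβ t)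
  have hS2 : MemLp (fun ω => ∑ r ∈ T, ξ r ω) 2 P := memLp_finsetSum _ hξ2
  have hvβ (t : ℤ) (ht : t ∈ T) (ω : Ω) : |ξ t ω * W t ω| ≤ β t * (2 * q * b) := by
    rw [abs_mul]
    exact mul_le_mul (hξ t ht ω) ((hWβ t ω).trans (hnearb t)) (abs_nonneg _) (hβ0 t ht)
  have hv2 (t : ℤ) (ht : t ∈ T) : MemLp (fun ω => ξ t ω * W t ω) 2 P :=
    hmem ((hξm t ht).mul (hWm t)) _ (hvβ t ht)
  have hV2 : MemLp (fun ω => ∑ t ∈ T, ξ t ω * W t ω) 2 P := memLp_finsetSum _ hv2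
  -- Since $\xi_t$ is orthogonal to $S-W_t$, the mean of $\sum\xi_tW_t$ is exactly $\mathbb E[S^2]$.
  -- Its deviation from $\mathbb E[S^2]$ is therefore controlled by a variance.
  have hs : ∫ ω, (∑ t ∈ T, ξ t ω) ^ 2 ∂P = ∫ ω, ∑ t ∈ T, ξ t ω * W t ω ∂P := by
    have hz (t : ℤ) (ht : t ∈ T) : ∫ ω, ξ t ω * (∑ r ∈ T, ξ r ω - W t ω) ∂P = 0 := by
      rw [(hRind t ht).integral_fun_mul_eq_mul_integral (hξm t ht).aestronglyMeasurable
        (hS2.sub (hW2 t)).aestronglyMeasurable, h0 t ht, zero_mul]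
    have hint (t : ℤ) (ht : t ∈ T) :
        Integrable (fun ω => ξ t ω * (∑ r ∈ T, ξ r ω - W t ω)) P :=
      (hξ2 t ht).integrable_mul (hS2.sub (hW2 t))
    have hz' : ∫ ω, ∑ t ∈ T, ξ t ω * (∑ r ∈ T, ξ r ω - W t ω) ∂P = 0 := by
      rw [integral_finsetSum _ hint]
      exact Finset.sum_eq_zero hz
    rw [← add_zero (∫ ω, ∑ t ∈ T, ξ t ω * W t ω ∂P), ← hz', ← integral_add
      (hV2.integrable (by norm_num)) (integrable_finsetSum _ hint)]
    congr 1
    ext ω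
    rw [← Finset.sum_add_distrib, sq, Finset.sum_mul]
    exact Finset.sum_congr rfl fun t _ => by ring
  -- $W_t$ involves windows $(s-q,s]$ with $|s-t|<q$, all inside $(t-2q,t+q]$. These larger windows
  -- have length $3q$, hence the decorrelation distance in `hvcov`.
  have hvm (t : ℤ) (ht : t ∈ T) :
      Measurable[⨆ i ∈ Set.Ioc (t - 2 * q : ℤ) (t + q), m i] (fun ω => ξ t ω * W t ω) := by
    refine Measurable.mul ((hm t ht).mono (hmono fun i hi => ?_) le_rfl) ?_
    · rw [Set.mem_Ioc] at hi ⊢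
      omega
    · refine Finset.measurable_fun_sum _ fun s hs => ?_
      have hs' := Finset.mem_filter.1 hs
      refine (hm s hs'.1).mono (hmono fun i hi => ?_) le_rfl
      have := abs_lt.1 hs'.2
      rw [Set.mem_Ioc] at hi ⊢
      omega
  have hvcov (t : ℤ) (ht : t ∈ T) (s : ℤ) (hs : s ∈ T) (hts : ¬ |s - t| < (3 * q : ℕ)) :
      cov[fun ω => ξ t ω * W t ω, fun ω => ξ s ω * W s ω; P] = 0 := by
    refine (indepFun_of_measurable_iSup hle hind ?_ (hvm t ht) (hvm s hs)).covariance_eq_zero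
      (hv2 t ht) (hv2 s hs)
    rw [Set.disjoint_left]
    intro i hi hi'
    rw [Set.mem_Ioc] at hi hi'
    refine hts ?_
    rw [abs_lt]
    push_cast
    omega
  -- The constant is $4\cdot(2q b)^2\cdot 2\cdot 3q\,/\,q^3b^2=96$: the covariance bound, two
  -- neighbourhood sums at most $2qb$, and a band of half-width $3q$.
  have hvar : Var[fun ω => ∑ t ∈ T, ξ t ω * W t ω; P] ≤ 96 * q ^ 3 * b ^ 2 * Q := by
    rw [← covariance_self hV2.aemeasurable, covariance_fun_sum_fun_sum' hv2 hv2]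
    calc _ ≤ ∑ t ∈ T, ∑ s ∈ T with |s - t| < (3 * q : ℕ),
          4 * ((β t * (2 * q * b)) * (β s * (2 * q * b))) := by
          refine Finset.sum_le_sum fun t ht => ?_
          rw [Finset.sum_filter]
          refine Finset.sum_le_sum fun s hs => ?_
          split_ifs with hts
          · exact (le_abs_self _).trans (abs_covariance_le_of_abs_le (hvβ t ht) (hvβ s hs))
          · exact (hvcov t ht s hs hts).le
      _ = 16 * (q * b) ^ 2 * ∑ t ∈ T, ∑ s ∈ T with |s - t| < (3 * q : ℕ), β t * β s := by
          simp only [Finset.mul_sum]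
          exact Finset.sum_congr rfl fun t _ => Finset.sum_congr rfl fun s _ => by ring
      _ ≤ 16 * (q * b) ^ 2 * (2 * (3 * q : ℕ) * Q) :=
          mul_le_mul_of_nonneg_left (sum_sum_mul_le_of_abs_sub_lt T β _) (by positivity)
      _ = _ := by push_cast; ring
  have hdev : ∫ ω, |∑ t ∈ T, ξ t ω * W t ω - ∫ ω, (∑ t ∈ T, ξ t ω) ^ 2 ∂P| ∂P ≤
      √(96 * q ^ 3 * b ^ 2 * Q) := by
    rw [hs]
    have hc := hV2.sub (memLp_const (∫ ω, ∑ t ∈ T, ξ t ω * W t ω ∂P))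
    refine (integral_abs_le_lpNorm_two hc).trans (Real.le_sqrt_of_sq_le ?_)
    rw [← hc.integral_sq_eq_lpNorm_sq]
    refine le_trans (le_of_eq ?_) hvar
    rw [variance_eq_integral hV2.aemeasurable]
    rfl
  have hthird : ∑ t ∈ T, ∫ ω, |ξ t ω| * W t ω ^ 2 ∂P ≤ 4 * q ^ 2 * b * Q := by
    calc _ ≤ ∑ t ∈ T, β t * ((∑ s ∈ near t, β s) * (2 * q * b)) := by
          refine Finset.sum_le_sum fun t ht => ?_
          have h := norm_integral_le_of_norm_le_const (μ := P)
            (C := β t * ((∑ s ∈ near t, β s) * (2 * q * b)))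
            (f := fun ω => |ξ t ω| * W t ω ^ 2) (.of_forall fun ω => by
              rw [Real.norm_eq_abs, abs_mul, abs_abs, abs_pow, sq]
              exact mul_le_mul (hξ t ht ω) (mul_le_mul (hWβ t ω) ((hWβ t ω).trans (hnearb t))
                (abs_nonneg _) (hnear0 t)) (by positivity) (hβ0 t ht))
          simpa using (le_abs_self _).trans h
      _ = 2 * q * b * ∑ t ∈ T, ∑ s ∈ T with |s - t| < q, β t * β s := by
          rw [Finset.mul_sum]
          refine Finset.sum_congr rfl fun t _ => ?_
          rw [← Finset.mul_sum]
          ring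
      _ ≤ 2 * q * b * (2 * q * Q) :=
          mul_le_mul_of_nonneg_left (sum_sum_mul_le_of_abs_sub_lt T β _) (by positivity)
      _ = _ := by ring
  -- The uniform bound `C` only secures integrability; it does not enter the estimate.
  refine (norm_integral_exp_sub_exp_le (C := ∑ s ∈ T, β s) (W := W)
    (integral_nonneg fun ω => sq_nonneg _) hξm (fun t _ => hWm t) hξb (fun t _ => hWb t) h0
    hRind).trans ?_
  linarith

end FiniteRangeDependence

/-! ### Covariances and $L^2$ convergence. -/

section CovarianceL2

variable {Ω : Type*} {mΩ : MeasurableSpace Ω} {P : Measure Ω} [IsProbabilityMeasure P]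

theorem lpNorm_sub_integral_sq {F : Ω → ℝ} (hF : MemLp F 2 P) :
    lpNorm (fun ω => F ω - ∫ x, F x ∂P) 2 P ^ 2 = Var[F; P] := by
  rw [variance_eq_integral hF.aemeasurable]
  exact (hF.sub (memLp_const (∫ x, F x ∂P))).integral_sq_eq_lpNorm_sq.symm

theorem lpNorm_sub_integral_le {F : Ω → ℝ} (hF : MemLp F 2 P) :
    lpNorm (fun ω => F ω - ∫ x, F x ∂P) 2 P ≤ lpNorm F 2 P := by
  refine (sq_le_sq₀ lpNorm_nonneg lpNorm_nonneg).1 ?_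
  rw [lpNorm_sub_integral_sq hF, ← hF.integral_sq_eq_lpNorm_sq]
  exact variance_le_expectation_sq hF.aestronglyMeasurable

theorem abs_covariance_le_lpNorm {F G : Ω → ℝ} (hF : MemLp F 2 P) (hG : MemLp G 2 P) :
    |cov[F, G; P]| ≤ lpNorm F 2 P * lpNorm G 2 P :=
  (abs_integral_mul_le_lpNorm_mul_lpNorm (hF.sub (memLp_const (∫ x, F x ∂P)))
    (hG.sub (memLp_const (∫ x, G x ∂P)))).trans
    (mul_le_mul (lpNorm_sub_integral_le hF) (lpNorm_sub_integral_le hG) lpNorm_nonneg lpNorm_nonneg)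

theorem tendsto_covariance_of_tendsto_lpNorm {ι : Type*} {l : Filter ι} {F G : ι → Ω → ℝ}
    {F' G' : Ω → ℝ} (hF : ∀ i, MemLp (F i) 2 P) (hG : ∀ i, MemLp (G i) 2 P)
    (hF' : MemLp F' 2 P) (hG' : MemLp G' 2 P)
    (hFl : Tendsto (fun i => lpNorm (F i - F') 2 P) l (𝓝 0))
    (hGl : Tendsto (fun i => lpNorm (G i - G') 2 P) l (𝓝 0)) :
    Tendsto (fun i => cov[F i, G i; P]) l (𝓝 cov[F', G'; P]) := by
  rw [tendsto_iff_norm_sub_tendsto_zero]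
  have hlim : Tendsto (fun i => lpNorm (F i - F') 2 P * (lpNorm G' 2 P + lpNorm (G i - G') 2 P) +
      lpNorm F' 2 P * lpNorm (G i - G') 2 P) l (𝓝 0) := by
    simpa using (hFl.mul (hGl.const_add (lpNorm G' 2 P))).add (hGl.const_mul (lpNorm F' 2 P))
  refine squeeze_zero (fun _ => norm_nonneg _) (fun i => ?_) hlim
  have h1 : cov[F i, G i; P] - cov[F', G'; P] =
      cov[F i - F', G i; P] + cov[F', G i - G'; P] := by
    rw [covariance_sub_left (hF i) hF' (hG i), covariance_sub_right hF' (hG i) hG']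
    ring
  rw [h1]
  refine (norm_add_le _ _).trans (add_le_add ?_ (abs_covariance_le_lpNorm hF' ((hG i).sub hG')))
  refine (abs_covariance_le_lpNorm ((hF i).sub hF') (hG i)).trans ?_
  exact mul_le_mul_of_nonneg_left (lpNorm_le_lpNorm_add_lpNorm_sub' hG' (by norm_num)) lpNorm_nonneg

theorem memLp_comp_of_lipschitzWith {E : Type*} [NormedAddCommGroup E] {f : E → ℝ} {K : ℝ≥0} (hf : LipschitzWith K f) {X : Ω → E}
    (hX : MemLp X 2 P) : MemLp (fun ω => f (X ω)) 2 P := by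
  have hg : MemLp (fun ω => |f 0| + K * ‖X ω‖) 2 P :=
    (memLp_const |f 0|).add (hX.norm.const_mul (K : ℝ))
  refine hg.mono
    (hf.continuous.comp_aestronglyMeasurable hX.1) (.of_forall fun ω => ?_)
  have h1 := hf.dist_le_mul (X ω) 0
  rw [dist_zero_right, Real.dist_eq] at h1
  have h2 := abs_sub_abs_le_abs_sub (f (X ω)) (f 0)
  rw [Real.norm_eq_abs]
  exact (by linarith : |f (X ω)| ≤ |f 0| + K * ‖X ω‖).trans (le_abs_self _)

end CovarianceL2

/-! ### Clamping to a bounded interval. -/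

section Clamp

/-- Truncation of a real number to `[-q, q]`. -/
def clamp (q : ℕ) (x : ℝ) : ℝ := max (-q) (min q x)

theorem abs_clamp_le (q : ℕ) (x : ℝ) : |clamp q x| ≤ q := by
  have hq : (0 : ℝ) ≤ q := Nat.cast_nonneg q
  rw [abs_le, clamp]
  exact ⟨le_max_left _ _, max_le (by linarith) (min_le_left _ _)⟩

theorem abs_clamp_sub_clamp_le (q : ℕ) (x y : ℝ) : |clamp q x - clamp q y| ≤ |x - y| := by
  unfold clamp
  refine (abs_max_sub_max_le_max _ _ _ _).trans ?_
  rw [sub_self, abs_zero]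
  refine max_le (abs_nonneg _) ((abs_min_sub_min_le_max _ _ _ _).trans ?_)
  rw [sub_self, abs_zero]
  exact max_le (abs_nonneg _) le_rfl

theorem continuous_clamp (q : ℕ) : Continuous (clamp q) := by
  unfold clamp
  fun_prop

theorem clamp_eq_self {q : ℕ} {x : ℝ} (h : |x| ≤ q) : clamp q x = x := by
  rw [abs_le] at h
  rw [clamp, min_eq_right h.2, max_eq_right h.1]

theorem abs_clamp_sub_self_le (q : ℕ) (x : ℝ) : |clamp q x - x| ≤ |x| := by
  have hq : (0 : ℝ) ≤ q := Nat.cast_nonneg q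
  unfold clamp
  rcases le_total 0 x with h | h
  · rw [abs_of_nonneg h, max_eq_right ((neg_nonpos.2 hq).trans (le_min hq h)), abs_le]
    constructor <;> linarith [min_le_right (q : ℝ) x, le_min hq h]
  · rw [abs_of_nonpos h, min_eq_right (h.trans hq), abs_le]
    constructor <;> linarith [le_max_right (-(q : ℝ)) x, max_le (neg_nonpos.2 hq) h]

theorem tendsto_lpNorm_clamp_sub {Ω : Type*} {mΩ : MeasurableSpace Ω} {P : Measure Ω}
    {F : Ω → ℝ} (hF : MemLp F 2 P) :
    Tendsto (fun q => lpNorm (fun ω => clamp q (F ω) - F ω) 2 P) atTop (𝓝 0) := by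
  have hm (q : ℕ) : AEStronglyMeasurable (fun ω => clamp q (F ω) - F ω) P :=
    ((continuous_clamp q).comp_aestronglyMeasurable hF.1).sub hF.1
  have hmem (q : ℕ) : MemLp (fun ω => clamp q (F ω) - F ω) 2 P :=
    hF.mono (hm q) (.of_forall fun ω => abs_clamp_sub_self_le q _)
  have hint : Tendsto (fun q : ℕ => ∫ ω, (clamp q (F ω) - F ω) ^ 2 ∂P) atTop
      (𝓝 (∫ ω, (0 : ℝ) ∂P)) := by
    refine tendsto_integral_of_dominated_convergence (fun ω => F ω ^ 2)
      (fun q => (hm q).pow 2) hF.integrable_sq (fun q => .of_forall fun ω => ?_)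
      (.of_forall fun ω => ?_)
    · rw [Real.norm_eq_abs, abs_pow, ← sq_abs (F ω)]
      exact pow_le_pow_left₀ (abs_nonneg _) (abs_clamp_sub_self_le q _) 2
    · refine tendsto_const_nhds.congr' ?_
      filter_upwards [eventually_ge_atTop ⌈|F ω|⌉₊] with q hq
      rw [clamp_eq_self (Nat.ceil_le.1 hq), sub_self]
      norm_num
  have h := hint.sqrt
  simp only [integral_zero, Real.sqrt_zero] at h
  refine h.congr fun q => ?_
  rw [(hmem q).integral_sq_eq_lpNorm_sq, Real.sqrt_sq lpNorm_nonneg]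

end Clamp

/-! ### Truncated linear functionals and their influences. -/

section LinearProcess

variable {E : Type*} [NormedAddCommGroup E] [NormedSpace ℝ E]

/-- The truncated linear functional `∑_{j < q} B j (z (-j))`. -/
noncomputable def linTrunc (B : ℕ → E →L[ℝ] E) (q : ℕ) (z : ℤ → E) : E :=
  ∑ j ∈ Finset.range q, B j (z (-(j : ℤ)))

/-- The linear functional `∑_{j ≥ 0} B j (z (-j))`. -/
noncomputable def linFull (B : ℕ → E →L[ℝ] E) (z : ℤ → E) : E := ∑' j : ℕ, B j (z (-(j : ℤ)))

/-- The bounded finite-range approximation of `obsFull`. -/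
noncomputable def obsTrunc (f : E → ℝ) (B : ℕ → E →L[ℝ] E) (q : ℕ) (z : ℤ → E) : ℝ :=
  clamp q (f (linTrunc B q z))

/-- The observable `f` of the linear functional of the innovations. -/
noncomputable def obsFull (f : E → ℝ) (B : ℕ → E →L[ℝ] E) (z : ℤ → E) : ℝ := f (linFull B z)

/-- The operator norms of the coefficients, extended by zero to negative indices. -/
noncomputable def coeffNorm (B : ℕ → E →L[ℝ] E) (j : ℤ) : ℝ := if 0 ≤ j then ‖B j.toNat‖ else 0

theorem coeffNorm_nonneg (B : ℕ → E →L[ℝ] E) (j : ℤ) : 0 ≤ coeffNorm B j := by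
  unfold coeffNorm
  split_ifs <;> positivity

theorem coeffNorm_natCast (B : ℕ → E →L[ℝ] E) (j : ℕ) : coeffNorm B (j : ℤ) = ‖B j‖ := by
  simp [coeffNorm]

theorem summable_coeffNorm {B : ℕ → E →L[ℝ] E} (hB : Summable fun j => ‖B j‖) :
    Summable (coeffNorm B) := by
  have hinj : Function.Injective ((↑) : ℕ → ℤ) := Nat.cast_injective
  refine (hinj.summable_iff fun j hj => ?_).1 (by simpa [Function.comp_def, coeffNorm_natCast])
  have : ¬ 0 ≤ j := fun h => hj ⟨j.toNat, Int.toNat_of_nonneg h⟩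
  simp [coeffNorm, this]

theorem abs_obsTrunc_le (f : E → ℝ) (B : ℕ → E →L[ℝ] E) (q : ℕ) (z : ℤ → E) :
    |obsTrunc f B q z| ≤ q := abs_clamp_le q _

theorem linTrunc_timeShift (B : ℕ → E →L[ℝ] E) (q : ℕ) (t : ℤ) (z : ℤ → E) :
    linTrunc B q (timeShift t z) = ∑ j ∈ Finset.range q, B j (z (t - (j : ℤ))) := by
  simp only [linTrunc, timeShift]
  exact Finset.sum_congr rfl fun j _ => by rw [neg_add_eq_sub]

theorem dependsOn_obsTrunc_timeShift (f : E → ℝ) (B : ℕ → E →L[ℝ] E) (q : ℕ) (t : ℤ) :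
    DependsOn (fun z => obsTrunc f B q (timeShift t z)) (Finset.Ioc (t - q) t : Set ℤ) := by
  intro z z' h
  simp only [obsTrunc, linTrunc_timeShift]
  congr 2
  refine Finset.sum_congr rfl fun j hj => ?_
  rw [h _ _]
  rw [Finset.mem_range] at hj
  rw [Finset.mem_coe, Finset.mem_Ioc]
  omega

/-- Only the summand $j=t-i$ reads coordinate $i$. If $j$ is negative or at least $q$, nothing
changes and the bound is trivial. -/
theorem norm_linTrunc_sub_hybrid_le (B : ℕ → E →L[ℝ] E) (q : ℕ) (t i : ℤ) (w : ℤ ⊕ ℤ → E) :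
    ‖linTrunc B q (timeShift t fun k => w (Sum.inl k)) -
        linTrunc B q (timeShift t fun k => w (hybrid {i} k))‖ ≤
      coeffNorm B (t - i) * ‖w (Sum.inl i) - w (Sum.inr i)‖ := by
  rw [linTrunc_timeShift, linTrunc_timeShift, ← Finset.sum_sub_distrib]
  have hterm (j : ℕ) : B j (w (Sum.inl (t - (j : ℤ)))) - B j (w (hybrid {i} (t - (j : ℤ)))) =
      if t - (j : ℤ) = i then B j (w (Sum.inl i) - w (Sum.inr i)) else 0 := by
    by_cases h : t - (j : ℤ) = i
    · simp [hybrid, h]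
    · simp [hybrid, h]
  simp only [hterm]
  have hnn : 0 ≤ coeffNorm B (t - i) * ‖w (Sum.inl i) - w (Sum.inr i)‖ :=
    mul_nonneg (coeffNorm_nonneg _ _) (norm_nonneg _)
  by_cases h : ∃ j ∈ Finset.range q, t - (j : ℤ) = i
  · obtain ⟨j, hj, hji⟩ := h
    rw [Finset.sum_eq_single_of_mem j hj fun j' _ hne => if_neg fun h' => hne (by omega),
      if_pos hji, show t - i = (j : ℤ) by omega, coeffNorm_natCast]
    exact (B j).le_opNorm _
  · rw [Finset.sum_eq_zero fun j hj => if_neg fun h' => h ⟨j, hj, h'⟩, norm_zero]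
    exact hnn

variable [MeasurableSpace E] {μ : Measure E} [IsProbabilityMeasure μ]

/-- Clamping is $1$-Lipschitz and cutting the series only removes influences, so the bound does not
depend on $q$. The factor $2$ is the triangle inequality for the two copies of the innovation. -/
theorem influence_obsTrunc_le {f : E → ℝ} {K : ℝ≥0} (hf : LipschitzWith K f)
    (hμ : MemLp (fun x : E => x) 2 μ) (B : ℕ → E →L[ℝ] E) (q : ℕ) (t i : ℤ) :
    influence μ (fun z => obsTrunc f B q (timeShift t z)) i ≤
      K * (2 * lpNorm (fun x : E => x) 2 μ) * coeffNorm B (t - i) := by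
  have hl : MemLp (fun w : ℤ ⊕ ℤ → E => w (Sum.inl i)) 2 (iidLaw (ℤ ⊕ ℤ) μ) :=
    hμ.comp_measurePreserving (measurePreserving_coord μ _)
  have hr : MemLp (fun w : ℤ ⊕ ℤ → E => w (Sum.inr i)) 2 (iidLaw (ℤ ⊕ ℤ) μ) :=
    hμ.comp_measurePreserving (measurePreserving_coord μ _)
  have hd := (hl.sub hr).norm.const_mul (K * coeffNorm B (t - i))
  refine (lpNorm_mono_of_norm_le hd fun w => ?_).trans ?_
  · rw [Real.norm_eq_abs]
    refine (abs_clamp_sub_clamp_le _ _ _).trans ((hf.dist_le_mul _ _).trans ?_)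
    rw [dist_eq_norm, mul_assoc]
    exact mul_le_mul_of_nonneg_left (norm_linTrunc_sub_hybrid_le B q t i w) K.2
  · have h1 : lpNorm (fun w : ℤ ⊕ ℤ → E => K * coeffNorm B (t - i) *
        ‖((fun w : ℤ ⊕ ℤ → E => w (Sum.inl i)) - fun w : ℤ ⊕ ℤ → E => w (Sum.inr i)) w‖) 2
          (iidLaw (ℤ ⊕ ℤ) μ) = K * coeffNorm B (t - i) *
        lpNorm ((fun w : ℤ ⊕ ℤ → E => w (Sum.inl i)) - fun w : ℤ ⊕ ℤ → E => w (Sum.inr i)) 2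
          (iidLaw (ℤ ⊕ ℤ) μ) := by
      rw [lpNorm_const_mul, lpNorm_norm (hl.sub hr).1,
        abs_of_nonneg (mul_nonneg K.coe_nonneg (coeffNorm_nonneg B (t - i)))]
    rw [h1]
    have h3 := lpNorm_sub_le (g := fun w : ℤ ⊕ ℤ → E => w (Sum.inr i)) hl (by norm_num)
    rw [(measurePreserving_coord μ (Sum.inl i : ℤ ⊕ ℤ)).lpNorm_comp hμ.1,
      (measurePreserving_coord μ (Sum.inr i : ℤ ⊕ ℤ)).lpNorm_comp hμ.1] at h3
    calc _ ≤ K * coeffNorm B (t - i) *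
          (lpNorm (fun x : E => x) 2 μ + lpNorm (fun x : E => x) 2 μ) :=
          mul_le_mul_of_nonneg_left h3 (mul_nonneg K.2 (coeffNorm_nonneg _ _))
      _ = _ := by ring

theorem memLp_linTrunc (B : ℕ → E →L[ℝ] E) (hμ : MemLp (fun x : E => x) 2 μ) (q : ℕ) :
    MemLp (linTrunc B q) 2 (iidLaw ℤ μ) :=
  memLp_finsetSum _ fun j _ => (B j).comp_memLp'
    (hμ.comp_measurePreserving (measurePreserving_coord μ (-(j : ℤ))))

variable [BorelSpace E] [SecondCountableTopology E]

theorem measurable_linTrunc (B : ℕ → E →L[ℝ] E) (q : ℕ) : Measurable (linTrunc B q) := by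
  unfold linTrunc
  fun_prop

theorem measurable_obsTrunc {f : E → ℝ} (hf : Continuous f) (B : ℕ → E →L[ℝ] E) (q : ℕ) :
    Measurable (obsTrunc f B q) :=
  ((continuous_clamp q).comp hf).measurable.comp (measurable_linTrunc B q)

theorem measurable_obsTrunc_timeShift {f : E → ℝ} (hf : Continuous f) (B : ℕ → E →L[ℝ] E) (q : ℕ)
    (t : ℤ) : Measurable[⨆ i ∈ Set.Ioc (t - q : ℤ) t,
      MeasurableSpace.comap (fun z : ℤ → E => z i) inferInstance]
      (fun z => obsTrunc f B q (timeShift t z)) := by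
  simp only [obsTrunc, linTrunc_timeShift]
  refine ((continuous_clamp q).comp hf).measurable.comp ?_
  refine Finset.measurable_fun_sum _ fun j hj => (B j).continuous.measurable.comp ?_
  rw [measurable_iff_comap_le]
  rw [Finset.mem_range] at hj
  exact le_iSup₂_of_le (f := fun (i : ℤ) (_ : i ∈ Set.Ioc (t - q : ℤ) t) =>
    MeasurableSpace.comap (fun z : ℤ → E => z i) inferInstance) (t - (j : ℤ))
    ⟨by omega, by omega⟩ le_rfl

theorem memLp_obsTrunc {f : E → ℝ} (hf : Continuous f) (B : ℕ → E →L[ℝ] E) (q : ℕ) :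
    MemLp (obsTrunc f B q) 2 (iidLaw ℤ μ) :=
  .of_bound (measurable_obsTrunc hf B q).aestronglyMeasurable q
    (.of_forall (abs_obsTrunc_le f B q))

theorem memLp_obsTrunc_timeShift {f : E → ℝ} (hf : Continuous f) (B : ℕ → E →L[ℝ] E) (q : ℕ) (t : ℤ) :
    MemLp (fun z => obsTrunc f B q (timeShift t z)) 2 (iidLaw ℤ μ) :=
  (memLp_obsTrunc hf B q).comp_measurePreserving (measurePreserving_timeShift μ t)

end LinearProcess

/-! ### The untruncated functional as an $L^2$ limit. -/

section SquareIntegrableLimit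

variable {E : Type*} [NormedAddCommGroup E] [NormedSpace ℝ E] [CompleteSpace E] [MeasurableSpace E]
  [BorelSpace E] [SecondCountableTopology E] {μ : Measure E} [IsProbabilityMeasure μ]

theorem ae_summable_linFull {B : ℕ → E →L[ℝ] E} (hB : Summable fun j => ‖B j‖)
    (hμ : MemLp (fun x : E => x) 2 μ) :
    ∀ᵐ z ∂(iidLaw ℤ μ), Summable fun j : ℕ => B j (z (-(j : ℤ))) := by
  have hfin : ∫⁻ x, ‖x‖ₑ ∂μ < ⊤ := (hμ.integrable (by norm_num)).hasFiniteIntegral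
  have hm (j : ℕ) : Measurable fun z : ℤ → E => ‖B j (z (-(j : ℤ)))‖ₑ := by fun_prop
  have hle (j : ℕ) : ∫⁻ z, ‖B j (z (-(j : ℤ)))‖ₑ ∂(iidLaw ℤ μ) ≤
      ‖B j‖ₑ * ∫⁻ x, ‖x‖ₑ ∂μ := by
    rw [← lintegral_const_mul _ measurable_enorm,
      ← (measurePreserving_coord μ (-(j : ℤ))).lintegral_comp (measurable_enorm.const_mul _)]
    exact lintegral_mono fun z => (B j).le_opENorm _
  have htot : ∫⁻ z, ∑' j : ℕ, ‖B j (z (-(j : ℤ)))‖ₑ ∂(iidLaw ℤ μ) ≠ ⊤ := by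
    rw [lintegral_tsum fun j => (hm j).aemeasurable]
    refine ne_top_of_le_ne_top ?_ (ENNReal.tsum_le_tsum hle)
    rw [ENNReal.tsum_mul_right]
    exact ENNReal.mul_ne_top (tsum_enorm_ne_top_iff_summable_norm.2 hB) hfin.ne
  filter_upwards [ae_lt_top (Measurable.tsum hm) htot] with z hz
  exact (tsum_enorm_ne_top_iff_summable_norm.1 hz.ne).of_norm

/-- Fatou's lemma along the almost surely convergent partial sums, each of which is bounded by
Minkowski's inequality. -/
theorem eLpNorm_linFull_sub_linTrunc_le {B : ℕ → E →L[ℝ] E} (hB : Summable fun j => ‖B j‖)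
    (hμ : MemLp (fun x : E => x) 2 μ) (q : ℕ) :
    eLpNorm (fun z => linFull B z - linTrunc B q z) 2 (iidLaw ℤ μ) ≤
      ENNReal.ofReal ((∑' j : ℕ, ‖B (j + q)‖) * lpNorm (fun x : E => x) 2 μ) := by
  have hlim : ∀ᵐ z ∂(iidLaw ℤ μ), Tendsto (fun n => linTrunc B (n + q) z - linTrunc B q z) atTop
      (𝓝 (linFull B z - linTrunc B q z)) := by
    filter_upwards [ae_summable_linFull hB hμ] with z hz
    exact ((tendsto_add_atTop_iff_nat q).2 hz.hasSum.tendsto_sum_nat).sub_const _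
  refine (Lp.eLpNorm_lim_le_liminf_eLpNorm
    (fun n => ((measurable_linTrunc B (n + q)).sub (measurable_linTrunc B q)).aestronglyMeasurable)
    _ hlim).trans ?_
  refine (liminf_le_liminf (.of_forall fun n => ?_)).trans_eq (liminf_const _)
  have hdiff : (linTrunc B (n + q) - linTrunc B q) =
      ∑ j ∈ Finset.range n, fun z : ℤ → E => B (j + q) (z (-((j + q : ℕ) : ℤ))) := by
    ext z
    rw [Pi.sub_apply, sub_eq_iff_eq_add', Finset.sum_apply, linTrunc, linTrunc, add_comm n q,
      Finset.sum_range_add]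
    simp only [add_comm q]
  have hterm (j : ℕ) : MemLp (fun z : ℤ → E => z (-(j : ℤ))) 2 (iidLaw ℤ μ) :=
    hμ.comp_measurePreserving (measurePreserving_coord μ (-(j : ℤ)))
  rw [← ofReal_lpNorm ((memLp_linTrunc B hμ (n + q)).sub (memLp_linTrunc B hμ q))]
  refine ENNReal.ofReal_le_ofReal ?_
  rw [hdiff]
  refine (lpNorm_sum_le (fun j _ => (B (j + q)).comp_memLp' (hterm (j + q))) (by norm_num)).trans ?_
  calc ∑ j ∈ Finset.range n, lpNorm (fun z : ℤ → E => B (j + q) (z (-((j + q : ℕ) : ℤ)))) 2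
        (iidLaw ℤ μ)
      ≤ ∑ j ∈ Finset.range n, ‖B (j + q)‖ * lpNorm (fun x : E => x) 2 μ := by
        refine Finset.sum_le_sum fun j _ => ?_
        refine (lpNorm_mono_of_norm_le ((hterm (j + q)).norm.const_mul ‖B (j + q)‖)
          fun z => (B (j + q)).le_opNorm _).trans_eq ?_
        rw [lpNorm_const_mul, abs_norm, lpNorm_norm (hterm (j + q)).1,
          (measurePreserving_coord μ _).lpNorm_comp hμ.1]
    _ ≤ _ := by
        rw [← Finset.sum_mul]
        exact mul_le_mul_of_nonneg_right (((summable_nat_add_iff q).2 hB).sum_le_tsum _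
          fun j _ => norm_nonneg _) lpNorm_nonneg

theorem aestronglyMeasurable_linFull {B : ℕ → E →L[ℝ] E} (hB : Summable fun j => ‖B j‖)
    (hμ : MemLp (fun x : E => x) 2 μ) : AEStronglyMeasurable (linFull B) (iidLaw ℤ μ) := by
  refine aestronglyMeasurable_of_tendsto_ae atTop
    (fun n => (measurable_linTrunc B n).aestronglyMeasurable) ?_
  filter_upwards [ae_summable_linFull hB hμ] with z hz
  exact hz.hasSum.tendsto_sum_nat

theorem memLp_linFull_sub_linTrunc {B : ℕ → E →L[ℝ] E} (hB : Summable fun j => ‖B j‖)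
    (hμ : MemLp (fun x : E => x) 2 μ) (q : ℕ) :
    MemLp (fun z => linFull B z - linTrunc B q z) 2 (iidLaw ℤ μ) :=
  ⟨(aestronglyMeasurable_linFull hB hμ).sub (measurable_linTrunc B q).aestronglyMeasurable,
    (eLpNorm_linFull_sub_linTrunc_le hB hμ q).trans_lt ENNReal.ofReal_lt_top⟩

theorem memLp_linFull {B : ℕ → E →L[ℝ] E} (hB : Summable fun j => ‖B j‖)
    (hμ : MemLp (fun x : E => x) 2 μ) : MemLp (linFull B) 2 (iidLaw ℤ μ) := by
  simpa [linTrunc] using memLp_linFull_sub_linTrunc hB hμ 0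

theorem tendsto_lpNorm_linFull_sub_linTrunc {B : ℕ → E →L[ℝ] E} (hB : Summable fun j => ‖B j‖)
    (hμ : MemLp (fun x : E => x) 2 μ) :
    Tendsto (fun q => lpNorm (fun z => linFull B z - linTrunc B q z) 2 (iidLaw ℤ μ)) atTop
      (𝓝 0) := by
  have h0 := (tendsto_sum_nat_add fun j => ‖B j‖).mul_const (lpNorm (fun x : E => x) 2 μ)
  rw [zero_mul] at h0
  refine squeeze_zero (fun _ => lpNorm_nonneg) (fun q => ?_) h0
  rw [← toReal_eLpNorm (memLp_linFull_sub_linTrunc hB hμ q).1]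
  exact ENNReal.toReal_le_of_le_ofReal
    (mul_nonneg (tsum_nonneg fun _ => norm_nonneg _) lpNorm_nonneg)
    (eLpNorm_linFull_sub_linTrunc_le hB hμ q)

theorem memLp_obsFull {f : E → ℝ} {K : ℝ≥0} (hf : LipschitzWith K f) {B : ℕ → E →L[ℝ] E}
    (hB : Summable fun j => ‖B j‖) (hμ : MemLp (fun x : E => x) 2 μ) :
    MemLp (obsFull f B) 2 (iidLaw ℤ μ) :=
  memLp_comp_of_lipschitzWith hf (memLp_linFull hB hμ)

/-- The clamped full observable is intermediate: one gap is controlled by the Lipschitz bound and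
the tail of the series, the other by dominated convergence. -/
theorem tendsto_lpNorm_obsTrunc_sub_obsFull {f : E → ℝ} {K : ℝ≥0} (hf : LipschitzWith K f)
    {B : ℕ → E →L[ℝ] E} (hB : Summable fun j => ‖B j‖) (hμ : MemLp (fun x : E => x) 2 μ) :
    Tendsto (fun q => lpNorm (obsTrunc f B q - obsFull f B) 2 (iidLaw ℤ μ)) atTop (𝓝 0) := by
  have h1 := (tendsto_lpNorm_linFull_sub_linTrunc hB hμ).const_mul (K : ℝ)
  have h2 := tendsto_lpNorm_clamp_sub (memLp_obsFull hf hB hμ)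
  have h3 := h1.add h2
  rw [mul_zero, zero_add] at h3
  refine squeeze_zero (fun _ => lpNorm_nonneg) (fun q => ?_) h3
  have hcl : MemLp (fun z => clamp q (obsFull f B z)) 2 (iidLaw ℤ μ) :=
    .of_bound ((continuous_clamp q).comp_aestronglyMeasurable (memLp_obsFull hf hB hμ).1) q
      (.of_forall fun z => abs_clamp_le q _)
  have htri : lpNorm (obsTrunc f B q - obsFull f B) 2 (iidLaw ℤ μ) ≤
      lpNorm (fun z => obsTrunc f B q z - clamp q (obsFull f B z)) 2 (iidLaw ℤ μ) +
        lpNorm (fun z => clamp q (obsFull f B z) - obsFull f B z) 2 (iidLaw ℤ μ) :=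
    lpNorm_sub_le_lpNorm_sub_add_lpNorm_sub
    (memLp_obsTrunc (μ := μ) hf.continuous B q) hcl (h := obsFull f B) (by norm_num)
  refine htri.trans (add_le_add ?_ le_rfl)
  have hd := memLp_linFull_sub_linTrunc hB hμ q
  refine (lpNorm_mono_of_norm_le (hd.norm.const_mul (K : ℝ)) fun z => ?_).trans_eq ?_
  · refine (abs_clamp_sub_clamp_le _ _ _).trans ((hf.dist_le_mul _ _).trans_eq ?_)
    rw [dist_comm, dist_eq_norm]
  · rw [lpNorm_const_mul, abs_of_nonneg K.coe_nonneg, lpNorm_norm hd.1]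

end SquareIntegrableLimit

/-! ### Summable autocorrelations and the weighted variance bound. -/

section CovarianceBounds

/-- The autocorrelation `∑ i, α i * α (i + h)` of a sequence. -/
noncomputable def autoCorr (α : ℤ → ℝ) (h : ℤ) : ℝ := ∑' i : ℤ, α i * α (i + h)

/-- The shear $(i,h)\mapsto(i,i+h)$ reduces this to the product series $(\sum\alpha)^2$. -/
theorem summable_mul_add_prod {α : ℤ → ℝ} (hα : Summable α) (h0 : ∀ i, 0 ≤ α i) :
    Summable fun p : ℤ × ℤ => α p.2 * α (p.2 + p.1) := by
  have h := (hα.mul_of_nonneg hα h0 h0)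
  have h2 := ((Equiv.prodShear (Equiv.refl ℤ) fun i : ℤ => Equiv.addLeft i).summable_iff).2 h
  exact h2.prod_symm

theorem summable_mul_add {α : ℤ → ℝ} (hα : Summable α) (h0 : ∀ i, 0 ≤ α i) (h : ℤ) :
    Summable fun i => α i * α (i + h) :=
  (summable_mul_add_prod hα h0).prod_factor h

theorem summable_autoCorr {α : ℤ → ℝ} (hα : Summable α) (h0 : ∀ i, 0 ≤ α i) :
    Summable (autoCorr α) :=
  (summable_mul_add_prod hα h0).prod

theorem sum_mul_le_autoCorr {α : ℤ → ℝ} (hα : Summable α) (h0 : ∀ i, 0 ≤ α i) (s t : ℤ)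
    (I : Finset ℤ) : ∑ i ∈ I, α (s - i) * α (t - i) ≤ autoCorr α (t - s) := by
  have hs : Summable fun i => α (s - i) * α (t - i) := by
    have := (Equiv.subLeft s).summable_iff.2 (summable_mul_add hα h0 (t - s))
    refine this.congr fun i => ?_
    simp only [Function.comp_apply, Equiv.subLeft_apply]
    congr 2
    ring
  refine (hs.sum_le_tsum I fun i _ => mul_nonneg (h0 _) (h0 _)).trans_eq ?_
  rw [autoCorr, ← (Equiv.subLeft s).tsum_eq fun i => α i * α (i + (t - s))]
  refine tsum_congr fun i => ?_
  simp only [Equiv.subLeft_apply]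
  congr 2
  ring

section Influence

variable {κ : Type*} {E : Type*} [MeasurableSpace E] {μ : Measure E} [IsProbabilityMeasure μ]

theorem memLp_sub_hybrid {F : (κ → E) → ℝ} (hF : MemLp F 2 (iidLaw κ μ)) (i : κ) :
    MemLp (fun w : κ ⊕ κ → E => F (fun k => w (Sum.inl k)) - F (fun k => w (hybrid {i} k))) 2
      (iidLaw (κ ⊕ κ) μ) :=
  (hF.comp_measurePreserving (measurePreserving_reindex μ Sum.inl_injective)).sub
    (hF.comp_measurePreserving (measurePreserving_reindex μ (hybrid_injective {i})))

theorem influence_le_two_mul_lpNorm {F : (κ → E) → ℝ} (hF : MemLp F 2 (iidLaw κ μ)) (i : κ) :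
    influence μ F i ≤ 2 * lpNorm F 2 (iidLaw κ μ) := by
  have hl := measurePreserving_reindex (E := E) μ (Sum.inl_injective (α := κ) (β := κ))
  have hh := measurePreserving_reindex (E := E) μ (hybrid_injective {i})
  have h := lpNorm_sub_le (g := fun w : κ ⊕ κ → E => F (fun k => w (hybrid {i} k)))
    (hF.comp_measurePreserving hl) (p := 2) (by norm_num)
  have e1 : lpNorm (F ∘ fun (w : κ ⊕ κ → E) k => w (Sum.inl k)) 2 (iidLaw (κ ⊕ κ) μ) =
    lpNorm F 2 (iidLaw κ μ) := hl.lpNorm_comp hF.1 2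
  rw [e1, hh.lpNorm_comp hF.1] at h
  rw [two_mul]
  exact h

theorem influence_sub_le {F G : (κ → E) → ℝ} (hF : MemLp F 2 (iidLaw κ μ))
    (i : κ) : influence μ (fun z => F z - G z) i ≤ influence μ F i + influence μ G i := by
  have h := lpNorm_sub_le (memLp_sub_hybrid hF i) (p := 2) (by norm_num)
    (g := fun w : κ ⊕ κ → E => G (fun k => w (Sum.inl k)) - G (fun k => w (hybrid {i} k)))
  refine le_of_eq_of_le ?_ h
  unfold influence
  congr 1
  ext w
  simp only [Pi.sub_apply]
  ring

theorem influence_sum_le {ι : Type*} (T : Finset ι) (c : ι → ℝ) {F : ι → (κ → E) → ℝ}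
    (hF : ∀ t ∈ T, MemLp (F t) 2 (iidLaw κ μ)) (i : κ) :
    influence μ (fun z => ∑ t ∈ T, c t * F t z) i ≤ ∑ t ∈ T, |c t| * influence μ (F t) i := by
  have h := lpNorm_sum_le (s := T) (p := 2) (μ := iidLaw (κ ⊕ κ) μ)
    (f := fun t (w : κ ⊕ κ → E) => c t * (F t (fun k => w (Sum.inl k)) -
      F t (fun k => w (hybrid {i} k))))
    (fun t ht => (memLp_sub_hybrid (hF t ht) i).const_mul (c t)) (by norm_num)
  simp only [lpNorm_const_mul] at h
  refine le_of_eq_of_le ?_ h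
  unfold influence
  congr 1
  ext w
  simp only [Finset.sum_apply, mul_sub, Finset.sum_sub_distrib]

end Influence

variable {E : Type*} [MeasurableSpace E] {μ : Measure E} [IsProbabilityMeasure μ]

/-- A variance bound for weighted sums of a stationary process with summable influences. -/
theorem variance_weighted_sum_le {H : (ℤ → E) → ℝ} (hHm : Measurable H)
    (hH : MemLp H 2 (iidLaw ℤ μ)) {θ : ℤ → ℝ} (hθ : Summable θ) (hθ0 : ∀ i, 0 ≤ θ i)
    (hinf : ∀ t i, influence μ (fun z => H (timeShift t z)) i ≤ θ (t - i))
    (hdep : ∀ t, ∃ I : Finset ℤ, DependsOn (fun z => H (timeShift t z)) (I : Set ℤ))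
    (T : Finset ℤ) (c : ℤ → ℝ) :
    Var[fun z => ∑ t ∈ T, c t * H (timeShift t z); iidLaw ℤ μ] ≤
      (∑' i, θ i) ^ 2 * ∑ t ∈ T, c t ^ 2 := by
  choose I hI using hdep
  have hHt (t : ℤ) : MemLp (fun z => H (timeShift t z)) 2 (iidLaw ℤ μ) :=
    hH.comp_measurePreserving (measurePreserving_timeShift μ t)
  have hS : MemLp (fun z => ∑ t ∈ T, c t * H (timeShift t z)) 2 (iidLaw ℤ μ) :=
    memLp_finsetSum _ fun t _ => (hHt t).const_mul (c t)
  have hSm : Measurable fun z => ∑ t ∈ T, c t * H (timeShift t z) :=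
    Finset.measurable_fun_sum _ fun t _ => (hHm.comp (measurable_timeShift t)).const_mul _
  have hSdep : DependsOn (fun z => ∑ t ∈ T, c t * H (timeShift t z)) (T.biUnion I : Set ℤ) := by
    intro z z' h
    refine Finset.sum_congr rfl fun t ht => ?_
    rw [show H (timeShift t z) = H (timeShift t z') from hI t fun i hi =>
      h i (Finset.mem_coe.2 (Finset.mem_biUnion.2 ⟨t, ht, Finset.mem_coe.1 hi⟩))]
  have hcov := abs_covariance_le_sum_influence hSm hSm hS hS hSdep
  rw [covariance_self hS.aemeasurable] at hcov
  set Θ := ∑' i, θ i with hΘ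
  have hΘ0 : 0 ≤ Θ := tsum_nonneg hθ0
  have hshift (i : ℤ) : ∑ t ∈ T, θ (t - i) ≤ Θ := by
    have h := ((Equiv.subRight i).summable_iff.2 hθ).sum_le_tsum T fun _ _ => hθ0 _
    exact h.trans_eq ((Equiv.subRight i).tsum_eq θ)
  have hrefl (t : ℤ) (J : Finset ℤ) : ∑ i ∈ J, θ (t - i) ≤ Θ := by
    have h := ((Equiv.subLeft t).summable_iff.2 hθ).sum_le_tsum J fun _ _ => hθ0 _
    exact h.trans_eq ((Equiv.subLeft t).tsum_eq θ)
  -- Cauchy–Schwarz with $\theta$ shared between the two factors, as in Schur's test; summing over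
  -- $i$ then yields the second factor $\Theta$.
  have hterm (i : ℤ) : influence μ (fun z => ∑ t ∈ T, c t * H (timeShift t z)) i *
      influence μ (fun z => ∑ t ∈ T, c t * H (timeShift t z)) i ≤
      Θ * ∑ t ∈ T, c t ^ 2 * θ (t - i) := by
    have h1 : influence μ (fun z => ∑ t ∈ T, c t * H (timeShift t z)) i ≤
        ∑ t ∈ T, |c t| * θ (t - i) :=
      (influence_sum_le T c (fun t _ => hHt t) i).trans
        (Finset.sum_le_sum fun t _ => mul_le_mul_of_nonneg_left (hinf t i) (abs_nonneg _))
    rw [← sq]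
    refine (pow_le_pow_left₀ (influence_nonneg _ _ _) h1 2).trans ?_
    refine (Finset.sum_sq_le_sum_mul_sum_of_sq_le_mul T (f := fun t => θ (t - i))
      (g := fun t => c t ^ 2 * θ (t - i)) (fun t _ => hθ0 _)
      (fun t _ => mul_nonneg (sq_nonneg _) (hθ0 _)) fun t _ => ?_).trans ?_
    · rw [mul_pow, sq_abs]
      exact le_of_eq (by ring)
    · exact mul_le_mul_of_nonneg_right (hshift i)
        (Finset.sum_nonneg fun t _ => mul_nonneg (sq_nonneg _) (hθ0 _))
  -- The covariance bound carries a spare factor $1/2$; discarding it needs this nonnegativity.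
  have hnn : 0 ≤ Θ ^ 2 * ∑ t ∈ T, c t ^ 2 :=
    mul_nonneg (sq_nonneg _) (Finset.sum_nonneg fun t _ => sq_nonneg _)
  have hmain : ∑ i ∈ T.biUnion I, influence μ (fun z => ∑ t ∈ T, c t * H (timeShift t z)) i *
      influence μ (fun z => ∑ t ∈ T, c t * H (timeShift t z)) i ≤
      Θ ^ 2 * ∑ t ∈ T, c t ^ 2 := by
    refine (Finset.sum_le_sum fun i _ => hterm i).trans ?_
    rw [← Finset.mul_sum, Finset.sum_comm, sq, mul_assoc]
    refine mul_le_mul_of_nonneg_left ?_ hΘ0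
    rw [Finset.mul_sum]
    refine Finset.sum_le_sum fun t _ => ?_
    rw [← Finset.mul_sum, mul_comm]
    exact mul_le_mul_of_nonneg_right (hrefl t _) (sq_nonneg _)
  linarith [le_abs_self (Var[fun z => ∑ t ∈ T, c t * H (timeShift t z); iidLaw ℤ μ])]

end CovarianceBounds

/-! ### Covariances of the linear process and uniform approximation. -/

section LinearProcessCovariance

variable {E : Type*} [NormedAddCommGroup E] [NormedSpace ℝ E] [MeasurableSpace E]
  [BorelSpace E] [SecondCountableTopology E] {μ : Measure E} [IsProbabilityMeasure μ]
  {B : ℕ → E →L[ℝ] E}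

/-- Influences decay like the coefficients, so their products sum to an autocorrelation. The
constant is $(2\sigma)^2/2$ times the Lipschitz constants. -/
theorem abs_covariance_obsTrunc_le {f g : E → ℝ} {K L : ℝ≥0} (hf : LipschitzWith K f)
    (hg : LipschitzWith L g) (hB : Summable fun j => ‖B j‖) (hμ : MemLp (fun x : E => x) 2 μ)
    (p q : ℕ) (s t : ℤ) :
    |cov[fun z => obsTrunc f B p (timeShift s z), fun z => obsTrunc g B q (timeShift t z);
      iidLaw ℤ μ]| ≤
      2 * K * L * lpNorm (fun x : E => x) 2 μ ^ 2 * autoCorr (coeffNorm B) (t - s) := by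
  refine (abs_covariance_le_sum_influence
    ((measurable_obsTrunc hf.continuous B p).comp (measurable_timeShift s))
    ((measurable_obsTrunc hg.continuous B q).comp (measurable_timeShift t))
    (memLp_obsTrunc_timeShift hf.continuous B p s) (memLp_obsTrunc_timeShift hg.continuous B q t)
    (dependsOn_obsTrunc_timeShift g B q t)).trans ?_
  set σ := lpNorm (fun x : E => x) 2 μ with hσ
  have hσ0 : 0 ≤ σ := lpNorm_nonneg
  calc _ ≤ (∑ i ∈ Finset.Ioc (t - q : ℤ) t, (K * (2 * σ) * coeffNorm B (s - i)) *
        (L * (2 * σ) * coeffNorm B (t - i))) / 2 := by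
        refine div_le_div_of_nonneg_right (Finset.sum_le_sum fun i _ => ?_) (by norm_num)
        exact mul_le_mul (influence_obsTrunc_le hf hμ B p s i) (influence_obsTrunc_le hg hμ B q t i)
          (influence_nonneg _ _ _) (mul_nonneg (by positivity) (coeffNorm_nonneg _ _))
    _ = 2 * K * L * σ ^ 2 *
        ∑ i ∈ Finset.Ioc (t - q : ℤ) t, coeffNorm B (s - i) * coeffNorm B (t - i) := by
        rw [Finset.mul_sum, Finset.sum_div]
        exact Finset.sum_congr rfl fun i _ => by ring
    _ ≤ _ := mul_le_mul_of_nonneg_left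
        (sum_mul_le_autoCorr (summable_coeffNorm hB) (coeffNorm_nonneg B) s t _) (by positivity)

variable [CompleteSpace E]

theorem tendsto_covariance_obsTrunc {f g : E → ℝ} {K L : ℝ≥0} (hf : LipschitzWith K f)
    (hg : LipschitzWith L g) (hB : Summable fun j => ‖B j‖) (hμ : MemLp (fun x : E => x) 2 μ)
    (s t : ℤ) :
    Tendsto (fun q => cov[fun z => obsTrunc f B q (timeShift s z),
      fun z => obsTrunc g B q (timeShift t z); iidLaw ℤ μ]) atTop
      (𝓝 cov[fun z => obsFull f B (timeShift s z), fun z => obsFull g B (timeShift t z);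
        iidLaw ℤ μ]) := by
  have key {f : E → ℝ} {K : ℝ≥0} (hf : LipschitzWith K f) (s : ℤ) :
      Tendsto (fun q => lpNorm ((fun z => obsTrunc f B q (timeShift s z)) -
        fun z => obsFull f B (timeShift s z)) 2 (iidLaw ℤ μ)) atTop (𝓝 0) := by
    refine (tendsto_lpNorm_obsTrunc_sub_obsFull hf hB hμ).congr fun q => ?_
    exact ((measurePreserving_timeShift μ s).lpNorm_comp
      ((memLp_obsTrunc hf.continuous B q).sub (memLp_obsFull hf hB hμ)).1 2).symm
  have hfull {f : E → ℝ} {K : ℝ≥0} (hf : LipschitzWith K f) (s : ℤ) :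
      MemLp (fun z => obsFull f B (timeShift s z)) 2 (iidLaw ℤ μ) :=
    (memLp_obsFull hf hB hμ).comp_measurePreserving (measurePreserving_timeShift μ s)
  exact tendsto_covariance_of_tendsto_lpNorm
    (fun q => memLp_obsTrunc_timeShift hf.continuous B q s)
    (fun q => memLp_obsTrunc_timeShift hg.continuous B q t) (hfull hf s) (hfull hg t)
    (key hf s) (key hg t)

theorem tendsto_tsum_min_abs {α : ℤ → ℝ} (hα : Summable α) (h0 : ∀ i, 0 ≤ α i) :
    Tendsto (fun δ : ℝ => ∑' i, min (α i) |δ|) (𝓝 0) (𝓝 0) := by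
  have h := tendsto_tsum_of_dominated_convergence (𝓕 := 𝓝 (0 : ℝ))
    (f := fun δ i => min (α i) |δ|) (g := fun i => min (α i) |0|) hα
    (fun i => (continuous_const.min continuous_abs).tendsto 0)
    (.of_forall fun δ i => by
      rw [Real.norm_of_nonneg (le_min (h0 i) (abs_nonneg δ))]
      exact min_le_left _ _)
  simpa [h0] using h

/-- The truncated observables approximate the weighted sums in `L²`, uniformly in the weights. -/
theorem eventually_lpNorm_weighted_sum_le {f : E → ℝ} {K : ℝ≥0} (hf : LipschitzWith K f)
    (hB : Summable fun j => ‖B j‖) (hμ : MemLp (fun x : E => x) 2 μ) {ε : ℝ} (hε : 0 < ε) :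
    ∀ᶠ q in atTop, ∀ (T : Finset ℤ) (c : ℤ → ℝ),
      lpNorm (fun z => ∑ t ∈ T, c t * (obsFull f B (timeShift t z) - ∫ x, obsFull f B x ∂(iidLaw ℤ μ))
        - ∑ t ∈ T, c t * (obsTrunc f B q (timeShift t z) - ∫ x, obsTrunc f B q x ∂(iidLaw ℤ μ)))
        2 (iidLaw ℤ μ) ≤ ε * √(∑ t ∈ T, c t ^ 2) := by
  set ν := iidLaw ℤ μ with hν
  set σ := lpNorm (fun x : E => x) 2 μ with hσ
  have hσ0 : 0 ≤ σ := lpNorm_nonneg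
  -- Bounds the influences of a difference of two truncations, hence the outer factor $2$.
  set α : ℤ → ℝ := fun i => 2 * (K * (2 * σ) * coeffNorm B i) with hαdef
  have hα : Summable α := ((summable_coeffNorm hB).mul_left _).mul_left _
  have hα0 (i : ℤ) : 0 ≤ α i :=
    mul_nonneg (by norm_num) (mul_nonneg (by positivity) (coeffNorm_nonneg _ _))
  -- The influence of the difference is at most $\alpha_j$, and also at most $\delta$ once the
  -- difference is small in $L^2$. The sum of the minima is small by dominated convergence.
  obtain ⟨δ, hδ0, hδ⟩ : ∃ δ > 0, ∑' i, min (α i) |δ| ≤ ε := by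
    have h1 : ∀ᶠ δ in 𝓝[>] (0 : ℝ), ∑' i, min (α i) |δ| ≤ ε :=
      ((tendsto_tsum_min_abs hα hα0).mono_left nhdsWithin_le_nhds).eventually (ge_mem_nhds hε)
    obtain ⟨δ, hδ, hδ0⟩ := (h1.and self_mem_nhdsWithin).exists
    exact ⟨δ, hδ0, hδ⟩
  set θ : ℤ → ℝ := fun i => min (α i) |δ| with hθdef
  have hθ0 (i : ℤ) : 0 ≤ θ i := le_min (hα0 i) (abs_nonneg δ)
  have hθ : Summable θ := hα.of_nonneg_of_le hθ0 fun i => min_le_left _ _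
  have hlim := tendsto_lpNorm_obsTrunc_sub_obsFull (μ := μ) hf hB hμ
  have hsmall : ∀ᶠ q in atTop, lpNorm (obsTrunc f B q - obsFull f B) 2 ν ≤ δ / 4 :=
    hlim.eventually (ge_mem_nhds (by positivity))
  have hT2 (q : ℕ) : MemLp (obsTrunc f B q) 2 ν := memLp_obsTrunc hf.continuous B q
  have hF2 : MemLp (obsFull f B) 2 ν := memLp_obsFull hf hB hμ
  filter_upwards [hsmall] with q hq T c
  have hsh {H : (ℤ → E) → ℝ} (hH : MemLp H 2 ν) (t : ℤ) :
      MemLp (fun z => H (timeShift t z)) 2 ν :=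
    hH.comp_measurePreserving (measurePreserving_timeShift μ t)
  have hsum {H : (ℤ → E) → ℝ} (hH : MemLp H 2 ν) :
      MemLp (fun z => ∑ t ∈ T, c t * H (timeShift t z)) 2 ν :=
    memLp_finsetSum _ fun t _ => (hsh hH t).const_mul (c t)
  have hcen {H : (ℤ → E) → ℝ} (hH : MemLp H 2 ν) (z : ℤ → E) :
      ∑ t ∈ T, c t * (H (timeShift t z) - ∫ x, H x ∂ν) =
        ∑ t ∈ T, c t * H (timeShift t z) - ∫ z, ∑ t ∈ T, c t * H (timeShift t z) ∂ν := by
    rw [integral_finsetSum _ fun t _ => ((hsh hH t).const_mul (c t)).integrable (by norm_num),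
      ← Finset.sum_sub_distrib]
    refine Finset.sum_congr rfl fun t _ => ?_
    rw [integral_const_mul,
      (measurePreserving_timeShift μ t).integral_comp_of_aestronglyMeasurable hH.1, mul_sub]
  -- The variance bound requires finite range, so level $q$ is compared with a finite level $Q$
  -- instead of the full observable. Both lie within $\delta/4$ of the limit, so their distance is
  -- at most $\delta/2$ and the influence at most $\delta$.
  have hvar : ∀ᶠ Q in atTop, lpNorm (fun z => ∑ t ∈ T, c t *
      ((obsTrunc f B Q - obsTrunc f B q) (timeShift t z) -
        ∫ x, (obsTrunc f B Q - obsTrunc f B q) x ∂ν)) 2 ν ≤ ε * √(∑ t ∈ T, c t ^ 2) := by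
    filter_upwards [hsmall] with Q hQ
    have hH2 : MemLp (obsTrunc f B Q - obsTrunc f B q) 2 ν := (hT2 Q).sub (hT2 q)
    have hHn : lpNorm (obsTrunc f B Q - obsTrunc f B q) 2 ν ≤ δ / 2 := by
      have h1 := lpNorm_sub_le_lpNorm_sub_add_lpNorm_sub (hT2 Q) hF2 (h := obsTrunc f B q)
        (p := 2) (by norm_num)
      rw [lpNorm_sub_comm (obsFull f B)] at h1
      linarith
    have hinf (t i : ℤ) : influence μ
        (fun z => (obsTrunc f B Q - obsTrunc f B q) (timeShift t z)) i ≤ θ (t - i) := by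
      refine le_min ?_ ?_
      · refine (influence_sub_le (hsh (hT2 Q) t) i).trans ?_
        rw [hαdef]
        have h1 := influence_obsTrunc_le hf hμ B Q t i
        have h2 := influence_obsTrunc_le hf hμ B q t i
        simp only
        linarith
      · refine (influence_le_two_mul_lpNorm (hsh hH2 t) i).trans ?_
        rw [(measurePreserving_timeShift μ t).lpNorm_comp hH2.1, abs_of_pos hδ0]
        linarith
    have hdep (t : ℤ) : ∃ I : Finset ℤ, DependsOn
        (fun z => (obsTrunc f B Q - obsTrunc f B q) (timeShift t z)) (I : Set ℤ) := by
      refine ⟨Finset.Ioc (t - Q : ℤ) t ∪ Finset.Ioc (t - q : ℤ) t, fun z z' h => ?_⟩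
      have h1 : obsTrunc f B Q (timeShift t z) = obsTrunc f B Q (timeShift t z') :=
        dependsOn_obsTrunc_timeShift f B Q t fun i hi => h i (by
          rw [Finset.coe_union]; exact Or.inl hi)
      have h2 : obsTrunc f B q (timeShift t z) = obsTrunc f B q (timeShift t z') :=
        dependsOn_obsTrunc_timeShift f B q t fun i hi => h i (by
          rw [Finset.coe_union]; exact Or.inr hi)
      simp only [Pi.sub_apply, h1, h2]
    have hv := variance_weighted_sum_le ((measurable_obsTrunc hf.continuous B Q).sub
      (measurable_obsTrunc hf.continuous B q)) hH2 hθ hθ0 hinf hdep T c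
    simp only [hcen hH2]
    refine (sq_le_sq₀ lpNorm_nonneg (by positivity)).1 ?_
    rw [lpNorm_sub_integral_sq (hsum hH2), mul_pow,
      Real.sq_sqrt (Finset.sum_nonneg fun t _ => sq_nonneg _)]
    refine hv.trans (mul_le_mul_of_nonneg_right ?_ (Finset.sum_nonneg fun t _ => sq_nonneg _))
    exact pow_le_pow_left₀ (tsum_nonneg hθ0) hδ 2
  -- For fixed weights, passing from level $Q$ to the full observable costs a crude triangle
  -- inequality, which vanishes as $Q\to\infty$.
  have hbound : ∀ᶠ Q in atTop,
      lpNorm (fun z => ∑ t ∈ T, c t * (obsFull f B (timeShift t z) - ∫ x, obsFull f B x ∂ν)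
        - ∑ t ∈ T, c t * (obsTrunc f B q (timeShift t z) - ∫ x, obsTrunc f B q x ∂ν)) 2 ν ≤
      ε * √(∑ t ∈ T, c t ^ 2) +
        ∑ t ∈ T, |c t| * lpNorm (obsTrunc f B Q - obsFull f B) 2 ν := by
    filter_upwards [hvar] with Q hQ
    have hH2 : MemLp (obsTrunc f B Q - obsTrunc f B q) 2 ν := (hT2 Q).sub (hT2 q)
    have hD2 : MemLp (obsFull f B - obsTrunc f B Q) 2 ν := hF2.sub (hT2 Q)
    have hsplit : (fun z => ∑ t ∈ T, c t * (obsFull f B (timeShift t z) - ∫ x, obsFull f B x ∂ν)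
        - ∑ t ∈ T, c t * (obsTrunc f B q (timeShift t z) - ∫ x, obsTrunc f B q x ∂ν)) =
        (fun z => ∑ t ∈ T, c t * ((obsTrunc f B Q - obsTrunc f B q) (timeShift t z) -
          ∫ x, (obsTrunc f B Q - obsTrunc f B q) x ∂ν)) +
        fun z => ∑ t ∈ T, c t * ((obsFull f B - obsTrunc f B Q) (timeShift t z) -
          ∫ x, (obsFull f B - obsTrunc f B Q) x ∂ν) := by
      have i1 := integral_sub ((hT2 Q).integrable (by norm_num)) ((hT2 q).integrable (by norm_num))
      have i2 := integral_sub (hF2.integrable (by norm_num)) ((hT2 Q).integrable (by norm_num))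
      ext z
      simp only [Pi.add_apply, Pi.sub_apply, i1, i2]
      rw [← Finset.sum_sub_distrib, ← Finset.sum_add_distrib]
      exact Finset.sum_congr rfl fun t _ => by ring
    have hm1 : MemLp (fun z => ∑ t ∈ T, c t * ((obsTrunc f B Q - obsTrunc f B q) (timeShift t z) -
          ∫ x, (obsTrunc f B Q - obsTrunc f B q) x ∂ν)) 2 ν := by
      simp only [hcen hH2]
      exact (hsum hH2).sub (memLp_const _)
    rw [hsplit]
    refine (lpNorm_add_le hm1 (by norm_num)).trans (add_le_add hQ ?_)
    simp only [hcen hD2]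
    refine (lpNorm_sub_integral_le (hsum hD2)).trans ?_
    have h1 := lpNorm_sum_le (s := T) (p := 2) (μ := ν)
      (f := fun t z => c t * (obsFull f B - obsTrunc f B Q) (timeShift t z))
      (fun t _ => (hsh hD2 t).const_mul (c t)) (by norm_num)
    have h2 : (∑ t ∈ T, fun z => c t * (obsFull f B - obsTrunc f B Q) (timeShift t z)) =
        fun z => ∑ t ∈ T, c t * (obsFull f B - obsTrunc f B Q) (timeShift t z) := by
      ext z
      rw [Finset.sum_apply]
    rw [h2] at h1
    refine h1.trans_eq (Finset.sum_congr rfl fun t _ => ?_)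
    rw [lpNorm_const_mul, (measurePreserving_timeShift μ t).lpNorm_comp hD2.1, lpNorm_sub_comm]
  have hlim2 : Tendsto (fun Q => ε * √(∑ t ∈ T, c t ^ 2) +
      ∑ t ∈ T, |c t| * lpNorm (obsTrunc f B Q - obsFull f B) 2 ν) atTop
      (𝓝 (ε * √(∑ t ∈ T, c t ^ 2))) := by
    have h1 := tendsto_finsetSum T fun t _ => hlim.const_mul |c t|
    simp only [mul_zero, Finset.sum_const_zero] at h1
    simpa using h1.const_add (ε * √(∑ t ∈ T, c t ^ 2))
  exact ge_of_tendsto hlim2 hbound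

end LinearProcessCovariance

/-! ### Lag products of the weights. -/

section Weights

theorem sum_eq_sum_add_left_of_support {F : ℤ → ℝ} {T T' : Finset ℤ} (s : ℤ)
    (hT : ∀ t ∉ T, F t = 0) (hT' : ∀ h ∉ T', F (s + h) = 0) :
    ∑ t ∈ T, F t = ∑ h ∈ T', F (s + h) := by
  rw [← tsum_eq_sum (L := .unconditional ℤ) hT, ← tsum_eq_sum (L := .unconditional ℤ) hT',
    ← (Equiv.addLeft s).tsum_eq F]
  rfl

variable {M : ℕ} {a : ℕ → ℤ → Fin M → ℝ}

/-- Substitute $t\mapsto t+h$; since the weights vanish outside $\{1,\dots,n\}$ there are no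
boundary terms. -/
theorem weightCross_neg (ha : ∀ (n : ℕ) (t : ℤ) (m : Fin M), t ∉ Set.Icc (1 : ℤ) n → a n t m = 0)
    (m l : Fin M) (h : ℤ) (n : ℕ) : weightCross a m l (-h) n = weightCross a l m h n := by
  have hmem {t : ℤ} : t ∉ Finset.Icc (1 : ℤ) n → t ∉ Set.Icc (1 : ℤ) n := by simp
  unfold weightCross
  rw [sum_eq_sum_add_left_of_support (T' := Finset.Icc (1 : ℤ) n) h]
  · congr 1
    refine Finset.sum_congr rfl fun t _ => ?_
    rw [add_comm h t, add_neg_cancel_right, mul_comm]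
  · intro t ht
    rw [ha n t m (hmem ht), zero_mul]
  · intro t ht
    rw [add_comm h t, add_neg_cancel_right, ha n t l (hmem ht), mul_zero]

theorem abs_weightCross_le
    (ha : ∀ (n : ℕ) (t : ℤ) (m : Fin M), t ∉ Set.Icc (1 : ℤ) n → a n t m = 0)
    (m l : Fin M) (h : ℤ) (n : ℕ) :
    |weightCross a m l h n| ≤ (weightCross a m m 0 n + weightCross a l l 0 n) / 2 := by
  have hl0 (t : ℤ) (ht : t ∉ Finset.Icc (1 : ℤ) n) : a n t l ^ 2 = 0 := by
    rw [ha n t l (by simpa using ht), sq, zero_mul]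
  have hs : Summable fun t => a n t l ^ 2 := (hasSum_sum_of_ne_finset_zero hl0).summable
  have hshift : ∑ t ∈ Finset.Icc (1 : ℤ) n, a n (t + h) l ^ 2 ≤
      ∑ t ∈ Finset.Icc (1 : ℤ) n, a n t l ^ 2 := by
    rw [← tsum_eq_sum (L := .unconditional ℤ) hl0,
      ← (Equiv.addRight h).tsum_eq fun t => a n t l ^ 2]
    exact ((Equiv.addRight h).summable_iff.2 hs).sum_le_tsum _ fun _ _ => sq_nonneg _
  have hle : |∑ t ∈ Finset.Icc (1 : ℤ) n, a n t m * a n (t + h) l| ≤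
      (∑ t ∈ Finset.Icc (1 : ℤ) n, a n t m ^ 2 + ∑ t ∈ Finset.Icc (1 : ℤ) n, a n t l ^ 2) / 2 := by
    calc _ ≤ ∑ t ∈ Finset.Icc (1 : ℤ) n, (a n t m ^ 2 + a n (t + h) l ^ 2) / 2 := by
          refine (Finset.abs_sum_le_sum_abs _ _).trans (Finset.sum_le_sum fun t _ => ?_)
          rw [abs_mul]
          nlinarith [sq_nonneg (|a n t m| - |a n (t + h) l|), sq_abs (a n t m),
            sq_abs (a n (t + h) l)]
      _ ≤ _ := by
          rw [← Finset.sum_div, Finset.sum_add_distrib]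
          linarith
  unfold weightCross
  simp only [add_zero, ← sq]
  rw [abs_mul, abs_of_nonneg (by positivity : (0 : ℝ) ≤ 1 / n)]
  calc _ ≤ 1 / (n : ℝ) * _ := mul_le_mul_of_nonneg_left hle (by positivity)
    _ = _ := by ring

theorem abs_le_weightMax
    (ha : ∀ (n : ℕ) (t : ℤ) (m : Fin M), t ∉ Set.Icc (1 : ℤ) n → a n t m = 0)
    (n : ℕ) (t : ℤ) (m : Fin M) : |a n t m| ≤ weightMax a n := by
  by_cases ht : t ∈ Finset.Icc (1 : ℤ) n
  · have h : ‖a n t m‖₊ ≤ (Finset.Icc (1 : ℤ) n ×ˢ (Finset.univ : Finset (Fin M))).sup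
        fun p => ‖a n p.1 p.2‖₊ :=
      Finset.le_sup (f := fun p : ℤ × Fin M => ‖a n p.1 p.2‖₊)
        (Finset.mem_product.2 ⟨ht, Finset.mem_univ m⟩ : (t, m) ∈ _)
    exact_mod_cast h
  · rw [ha n t m (by simpa using ht), abs_zero]
    exact NNReal.coe_nonneg _

theorem weightCross_zero_eq (m : Fin M) (n : ℕ) :
    weightCross a m m 0 n = (1 / (n : ℝ)) * ∑ t ∈ Finset.Icc (1 : ℤ) n, a n t m ^ 2 := by
  simp only [weightCross, add_zero, sq]

/-- Grouping the pairs $(s,t)$ by their lag $t-s$ expresses a quadratic form in the weights through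
the quantities of (W1). -/
theorem sum_sum_mul_eq_sum_weightCross
    (ha : ∀ (n : ℕ) (t : ℤ) (m : Fin M), t ∉ Set.Icc (1 : ℤ) n → a n t m = 0)
    (m l : Fin M) (n : ℕ) {γ : ℤ → ℝ} {R : Finset ℤ} (hγ : ∀ h ∉ R, γ h = 0) :
    (1 / (n : ℝ)) * ∑ s ∈ Finset.Icc (1 : ℤ) n, ∑ t ∈ Finset.Icc (1 : ℤ) n,
        a n s m * a n t l * γ (t - s) = ∑ h ∈ R, weightCross a m l h n * γ h := by
  have hrow (s : ℤ) : ∑ t ∈ Finset.Icc (1 : ℤ) n, a n s m * a n t l * γ (t - s) =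
      ∑ h ∈ R, a n s m * a n (s + h) l * γ h := by
    rw [sum_eq_sum_add_left_of_support (T' := R) s]
    · simp only [add_sub_cancel_left]
    · intro t ht
      rw [ha n t l (by simpa using ht), mul_zero, zero_mul]
    · intro h hh
      rw [add_sub_cancel_left, hγ h hh, mul_zero]
  simp only [hrow]
  rw [Finset.sum_comm, Finset.mul_sum]
  refine Finset.sum_congr rfl fun h _ => ?_
  rw [weightCross, mul_assoc, Finset.sum_mul]

end Weights

/-! ### Second moments of centered linear combinations. -/

section SecondMoment

variable {Ω : Type*} {mΩ : MeasurableSpace Ω} {P : Measure Ω} [IsProbabilityMeasure P]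

theorem integral_sq_sum_centered {ι : Type*} (T : Finset ι) (w : ι → ℝ) {Y : ι → Ω → ℝ}
    (hY : ∀ p ∈ T, MemLp (Y p) 2 P) :
    ∫ ω, (∑ p ∈ T, w p * (Y p ω - ∫ x, Y p x ∂P)) ^ 2 ∂P =
      ∑ p ∈ T, ∑ r ∈ T, w p * w r * cov[Y p, Y r; P] := by
  have hc (p : ι) (hp : p ∈ T) : MemLp (fun ω => Y p ω - ∫ x, Y p x ∂P) 2 P :=
    (hY p hp).sub (memLp_const _)
  have hi (p : ι) (hp : p ∈ T) (r : ι) (hr : r ∈ T) : Integrable (fun ω => w p * w r *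
      ((Y p ω - ∫ x, Y p x ∂P) * (Y r ω - ∫ x, Y r x ∂P))) P :=
    ((hc p hp).integrable_mul (hc r hr)).const_mul (w p * w r)
  have hexp (ω : Ω) : (∑ p ∈ T, w p * (Y p ω - ∫ x, Y p x ∂P)) ^ 2 = ∑ p ∈ T, ∑ r ∈ T,
      w p * w r * ((Y p ω - ∫ x, Y p x ∂P) * (Y r ω - ∫ x, Y r x ∂P)) := by
    rw [sq, Finset.sum_mul_sum]
    exact Finset.sum_congr rfl fun p _ => Finset.sum_congr rfl fun r _ => by ring
  simp only [hexp]
  rw [integral_finsetSum _ fun p hp => integrable_finsetSum _ fun r hr => hi p hp r hr]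
  refine Finset.sum_congr rfl fun p hp => ?_
  rw [integral_finsetSum _ fun r hr => hi p hp r hr]
  refine Finset.sum_congr rfl fun r hr => ?_
  rw [integral_const_mul, covariance]

end SecondMoment

/-! ### Stationarity and lag reversal of cross-covariances. -/

section StationaryCovariance

variable {E : Type*} [MeasurableSpace E]

/-- The lag-`h` cross-covariance of the stationary processes generated by `F` and `G`. -/
noncomputable def autoCov (μ : Measure E) (F G : (ℤ → E) → ℝ) (h : ℤ) : ℝ :=
  cov[F, fun z => G (timeShift h z); iidLaw ℤ μ]

variable {μ : Measure E} [IsProbabilityMeasure μ]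

theorem covariance_timeShift {F G : (ℤ → E) → ℝ} (hF : AEStronglyMeasurable F (iidLaw ℤ μ))
    (hG : AEStronglyMeasurable G (iidLaw ℤ μ)) (s t : ℤ) :
    cov[fun z => F (timeShift s z), fun z => G (timeShift t z); iidLaw ℤ μ] =
      autoCov μ F G (t - s) := by
  have hs := measurePreserving_timeShift μ s
  have hG' : AEStronglyMeasurable (fun z => G (timeShift (t - s) z)) (iidLaw ℤ μ) :=
    hG.comp_measurePreserving (measurePreserving_timeShift μ (t - s))
  have h := covariance_map_fun (μ := iidLaw ℤ μ) (Z := timeShift s) (X := F)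
    (Y := fun z => G (timeShift (t - s) z)) (by rwa [hs.map_eq]) (by rwa [hs.map_eq])
    hs.measurable.aemeasurable
  rw [hs.map_eq] at h
  rw [autoCov, h]
  simp only [timeShift_timeShift, sub_add_cancel]

theorem autoCov_neg {F G : (ℤ → E) → ℝ} (hF : AEStronglyMeasurable F (iidLaw ℤ μ))
    (hG : AEStronglyMeasurable G (iidLaw ℤ μ)) (h : ℤ) :
    autoCov μ F G (-h) = autoCov μ G F h := by
  rw [← sub_zero h, ← covariance_timeShift hG hF 0 h, covariance_comm,
    covariance_timeShift hF hG h 0]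
  simp

end StationaryCovariance

/-! ### Linear combinations on the space of innovation sequences. -/

section CanonicalLimit

theorem norm_exp_mul_I_sub_exp_mul_I_le (x y : ℝ) :
    ‖Complex.exp (x * Complex.I) - Complex.exp (y * Complex.I)‖ ≤ |x - y| := by
  have h : Complex.exp (x * Complex.I) - Complex.exp (y * Complex.I) =
      Complex.exp (y * Complex.I) * (Complex.exp (Complex.I * ((x - y : ℝ) : ℂ)) - 1) := by
    rw [mul_sub, ← Complex.exp_add, mul_one]
    congr 2
    push_cast
    ring
  rw [h, norm_mul, Complex.norm_exp_ofReal_mul_I, one_mul]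
  exact Real.norm_exp_I_mul_ofReal_sub_one_le

/-- Exchange of limits: the level $q$ is fixed before $n\to\infty$, so the approximation need only
hold for large $n$ depending on $q$. -/
theorem tendsto_of_forall_approx {F : Type*} [PseudoMetricSpace F] {u : ℕ → F} {v : ℕ → ℕ → F}
    {w : ℕ → F} {L : F} (hv : ∀ q, Tendsto (v q) atTop (𝓝 (w q))) (hw : Tendsto w atTop (𝓝 L))
    (happ : ∀ ε > 0, ∀ᶠ q in atTop, ∀ᶠ n in atTop, dist (u n) (v q n) ≤ ε) :
    Tendsto u atTop (𝓝 L) := by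
  rw [Metric.tendsto_nhds]
  intro ε hε
  obtain ⟨q, hq1, hq2⟩ := ((happ (ε / 3) (by positivity)).and
    (Metric.tendsto_nhds.1 hw (ε / 3) (by positivity))).exists
  filter_upwards [hq1, Metric.tendsto_nhds.1 (hv q) (ε / 3) (by positivity)] with n h1 h2
  have h3 := dist_triangle4 (u n) (v q n) (w q) L
  linarith

variable {E : Type*} [MeasurableSpace E] {M : ℕ}

/-- The linear combination with coefficients `c` of the normalized weighted centered sums of the
stationary processes generated by `H`. -/
noncomputable def linComb (μ : Measure E) (a : ℕ → ℤ → Fin M → ℝ) (H : Fin M → (ℤ → E) → ℝ)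
    (c : Fin M → ℝ) (n : ℕ) (z : ℤ → E) : ℝ :=
  (√(n : ℝ))⁻¹ * ∑ m, c m * ∑ t ∈ Finset.Icc (1 : ℤ) n,
    a n t m * (H m (timeShift t z) - ∫ x, H m x ∂(iidLaw ℤ μ))

/-- The limiting variance of `linComb`. -/
noncomputable def limitVar (μ : Measure E) (G : Fin M → Fin M → ℤ → ℝ)
    (H : Fin M → (ℤ → E) → ℝ) (c : Fin M → ℝ) : ℝ :=
  ∑ m, ∑ l, c m * c l * ∑' h : ℤ, G m l h * autoCov μ (H m) (H l) h

theorem linComb_eq_sum (μ : Measure E) (a : ℕ → ℤ → Fin M → ℝ) (H : Fin M → (ℤ → E) → ℝ)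
    (c : Fin M → ℝ) (n : ℕ) (z : ℤ → E) :
    linComb μ a H c n z = ∑ t ∈ Finset.Icc (1 : ℤ) n, ∑ m, (√(n : ℝ))⁻¹ * c m * a n t m *
      (H m (timeShift t z) - ∫ x, H m x ∂(iidLaw ℤ μ)) := by
  rw [linComb, Finset.sum_comm, Finset.mul_sum]
  refine Finset.sum_congr rfl fun m _ => ?_
  rw [← mul_assoc, Finset.mul_sum]
  exact Finset.sum_congr rfl fun t _ => by ring

variable {μ : Measure E} [IsProbabilityMeasure μ] {a : ℕ → ℤ → Fin M → ℝ}

theorem inv_sqrt_natCast_mul_self (n : ℕ) : (√(n : ℝ))⁻¹ * (√(n : ℝ))⁻¹ = 1 / (n : ℝ) := by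
  rw [← mul_inv, Real.mul_self_sqrt (Nat.cast_nonneg n), one_div]

theorem integral_linComb_sq
    (ha : ∀ (n : ℕ) (t : ℤ) (m : Fin M), t ∉ Set.Icc (1 : ℤ) n → a n t m = 0)
    {H : Fin M → (ℤ → E) → ℝ} (hH : ∀ m, MemLp (H m) 2 (iidLaw ℤ μ)) {R : Finset ℤ}
    (hR : ∀ m l, ∀ h ∉ R, autoCov μ (H m) (H l) h = 0) (c : Fin M → ℝ) (n : ℕ) :
    ∫ z, linComb μ a H c n z ^ 2 ∂(iidLaw ℤ μ) = ∑ m, ∑ l, c m * c l *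
      ∑ h ∈ R, weightCross a m l h n * autoCov μ (H m) (H l) h := by
  set Y : ℤ × Fin M → (ℤ → E) → ℝ := fun p z => H p.2 (timeShift p.1 z) with hYdef
  have hY (p : ℤ × Fin M) : MemLp (Y p) 2 (iidLaw ℤ μ) :=
    (hH p.2).comp_measurePreserving (measurePreserving_timeShift μ p.1)
  have hmean (p : ℤ × Fin M) : ∫ x, Y p x ∂(iidLaw ℤ μ) = ∫ x, H p.2 x ∂(iidLaw ℤ μ) :=
    (measurePreserving_timeShift μ p.1).integral_comp_of_aestronglyMeasurable (hH p.2).1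
  have hlin (z : ℤ → E) : linComb μ a H c n z =
      ∑ p ∈ Finset.Icc (1 : ℤ) n ×ˢ Finset.univ, ((√(n : ℝ))⁻¹ * c p.2 * a n p.1 p.2) *
        (Y p z - ∫ x, Y p x ∂(iidLaw ℤ μ)) := by
    simp only [hmean]
    rw [linComb_eq_sum, Finset.sum_product]
  simp only [hlin]
  rw [integral_sq_sum_centered _ _ fun p _ => hY p]
  have hcov (p r : ℤ × Fin M) : cov[Y p, Y r; iidLaw ℤ μ] =
      autoCov μ (H p.2) (H r.2) (r.1 - p.1) := covariance_timeShift (hH _).1 (hH _).1 _ _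
  simp only [hcov, Finset.sum_product]
  rw [Finset.sum_comm]
  refine Finset.sum_congr rfl fun m _ => ?_
  refine (Finset.sum_congr rfl fun s _ => Finset.sum_comm).trans (Finset.sum_comm.trans
    (Finset.sum_congr rfl fun l _ => ?_))
  rw [← sum_sum_mul_eq_sum_weightCross ha m l n (hR m l), ← inv_sqrt_natCast_mul_self]
  simp only [Finset.mul_sum]
  exact Finset.sum_congr rfl fun s _ => Finset.sum_congr rfl fun t _ => by ring

theorem iIndep_coord (μ : Measure E) [IsProbabilityMeasure μ] :
    iIndep (fun i : ℤ => MeasurableSpace.comap (fun z : ℤ → E => z i) inferInstance)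
      (iidLaw ℤ μ) :=
  (iIndepFun_infinitePi (P := fun _ : ℤ => μ) (X := fun _ x => x) fun _ => measurable_id :
    iIndepFun (fun (i : ℤ) (w : ℤ → E) => w i) (iidLaw ℤ μ))

end CanonicalLimit

/-! ### The limit theorem for truncated observables. -/

section TruncatedLimit

variable {E : Type*} [NormedAddCommGroup E] [NormedSpace ℝ E] [MeasurableSpace E] [BorelSpace E]
  [SecondCountableTopology E] {M : ℕ} {μ : Measure E} [IsProbabilityMeasure μ]
  {a : ℕ → ℤ → Fin M → ℝ} {B : ℕ → E →L[ℝ] E}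

/-- For $|h|\ge q$ the windows $(-q,0]$ and $(h-q,h]$ are disjoint. -/
theorem autoCov_obsTrunc_eq_zero {f g : E → ℝ} (hf : Continuous f) (hg : Continuous g)
    (B : ℕ → E →L[ℝ] E) (q : ℕ) {h : ℤ} (hh : h ∉ Finset.Ioo (-q : ℤ) q) :
    autoCov μ (obsTrunc f B q) (obsTrunc g B q) h = 0 := by
  have hm := measurable_obsTrunc_timeShift hf B q 0
  simp only [timeShift_zero] at hm
  refine (indepFun_of_measurable_iSup (fun i => (measurable_pi_apply i).comap_le) (iIndep_coord μ)
    ?_ hm (measurable_obsTrunc_timeShift hg B q h)).covariance_eq_zero (memLp_obsTrunc hf B q)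
    (memLp_obsTrunc_timeShift hg B q h)
  rw [Set.disjoint_left]
  intro i hi hi'
  rw [Set.mem_Ioc] at hi hi'
  rw [Finset.mem_Ioo] at hh
  omega

variable {f : Fin M → E → ℝ} {K : Fin M → ℝ≥0} {G : Fin M → Fin M → ℤ → ℝ}

theorem limitVar_obsTrunc (hf : ∀ m, LipschitzWith (K m) (f m)) (q : ℕ) (c : Fin M → ℝ) :
    limitVar μ G (fun m => obsTrunc (f m) B q) c = ∑ m, ∑ l, c m * c l *
      ∑ h ∈ Finset.Ioo (-q : ℤ) q, G m l h *
        autoCov μ (obsTrunc (f m) B q) (obsTrunc (f l) B q) h := by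
  refine Finset.sum_congr rfl fun m _ => Finset.sum_congr rfl fun l _ => ?_
  rw [tsum_eq_sum (L := .unconditional ℤ) fun h hh => by
    rw [autoCov_obsTrunc_eq_zero (hf m).continuous (hf l).continuous B q hh, mul_zero]]

theorem tendsto_integral_linComb_obsTrunc_sq
    (ha : ∀ (n : ℕ) (t : ℤ) (m : Fin M), t ∉ Set.Icc (1 : ℤ) n → a n t m = 0)
    (hf : ∀ m, LipschitzWith (K m) (f m))
    (hW1 : ∀ m l h, Tendsto (weightCross a m l h) atTop (𝓝 (G m l h))) (q : ℕ) (c : Fin M → ℝ) :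
    Tendsto (fun n => ∫ z, linComb μ a (fun m => obsTrunc (f m) B q) c n z ^ 2 ∂(iidLaw ℤ μ)) atTop
      (𝓝 (limitVar μ G (fun m => obsTrunc (f m) B q) c)) := by
  rw [limitVar_obsTrunc hf]
  refine Tendsto.congr (fun n => (integral_linComb_sq ha
    (fun m => memLp_obsTrunc (hf m).continuous B q) (R := Finset.Ioo (-q : ℤ) q)
    (fun m l h hh => autoCov_obsTrunc_eq_zero (hf m).continuous (hf l).continuous B q hh)
    c n).symm) ?_
  exact tendsto_finsetSum _ fun m _ => tendsto_finsetSum _ fun l _ =>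
    (tendsto_finsetSum _ fun h _ => (hW1 m l h).mul_const _).const_mul _

theorem tendsto_integral_exp_linComb_obsTrunc
    (ha : ∀ (n : ℕ) (t : ℤ) (m : Fin M), t ∉ Set.Icc (1 : ℤ) n → a n t m = 0)
    (hf : ∀ m, LipschitzWith (K m) (f m))
    (hW1 : ∀ m l h, Tendsto (weightCross a m l h) atTop (𝓝 (G m l h)))
    (hW2 : weightMax a =o[atTop] fun n : ℕ => √(n : ℝ)) (q : ℕ) (c : Fin M → ℝ) :
    Tendsto (fun n => ∫ z, Complex.exp
      ((linComb μ a (fun m => obsTrunc (f m) B q) c n z : ℝ) * Complex.I) ∂(iidLaw ℤ μ)) atTop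
      (𝓝 (Real.exp (-(limitVar μ G (fun m => obsTrunc (f m) B q) c) / 2) : ℂ)) := by
  have hvar := tendsto_integral_linComb_obsTrunc_sq (μ := μ) (B := B) ha hf hW1 q c
  set mean : Fin M → ℝ := fun m => ∫ x, obsTrunc (f m) B q x ∂(iidLaw ℤ μ) with hmean
  have hmeanle (m : Fin M) : |mean m| ≤ q := by
    simpa using norm_integral_le_of_norm_le_const (μ := iidLaw ℤ μ) (f := obsTrunc (f m) B q)
      (.of_forall (abs_obsTrunc_le (f m) B q))
  -- All channels at time $t$ form one summand. Here `β` bounds it pointwise, `b` bounds `β`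
  -- uniformly and tends to $0$ by (W2), and `U` bounds $\sum\beta^2$ and converges by (W1) at lag
  -- $0$.
  set ξ : ℕ → ℤ → (ℤ → E) → ℝ := fun n t z => ∑ m, (√(n : ℝ))⁻¹ * c m * a n t m *
      (obsTrunc (f m) B q (timeShift t z) - mean m) with hξdef
  set β : ℕ → ℤ → ℝ := fun n t => (√(n : ℝ))⁻¹ * (2 * q) * ∑ m, |c m| * |a n t m| with hβdef
  set b : ℕ → ℝ := fun n => 2 * q * (∑ m, |c m|) * (weightMax a n / √(n : ℝ)) with hbdef
  set U : ℕ → ℝ := fun n => (2 * q) ^ 2 * (∑ m, c m ^ 2) * ∑ m, weightCross a m m 0 n with hUdef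
  have hmax0 (n : ℕ) : 0 ≤ weightMax a n := NNReal.coe_nonneg _
  have hb0 (n : ℕ) : 0 ≤ b n := by
    have := hmax0 n
    positivity
  have hξβ (n : ℕ) (t : ℤ) (z : ℤ → E) : |ξ n t z| ≤ β n t := by
    rw [hξdef, hβdef]
    simp only [Finset.mul_sum]
    refine (Finset.abs_sum_le_sum_abs _ _).trans (Finset.sum_le_sum fun m _ => ?_)
    have h1 : |obsTrunc (f m) B q (timeShift t z) - mean m| ≤ 2 * q := by
      have := abs_sub (obsTrunc (f m) B q (timeShift t z)) (mean m)
      linarith [hmeanle m, abs_obsTrunc_le (f m) B q (timeShift t z)]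
    rw [abs_mul, abs_mul, abs_mul, abs_of_nonneg (by positivity : 0 ≤ (√(n : ℝ))⁻¹)]
    calc _ ≤ (√(n : ℝ))⁻¹ * |c m| * |a n t m| * (2 * q) :=
          mul_le_mul_of_nonneg_left h1 (by positivity)
      _ = _ := by ring
  have hβb (n : ℕ) (t : ℤ) : β n t ≤ b n := by
    rw [hβdef, hbdef]
    simp only
    calc _ ≤ (√(n : ℝ))⁻¹ * (2 * q) * ∑ m, |c m| * weightMax a n :=
          mul_le_mul_of_nonneg_left (Finset.sum_le_sum fun m _ =>
            mul_le_mul_of_nonneg_left (abs_le_weightMax ha n t m) (abs_nonneg _)) (by positivity)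
      _ = _ := by rw [← Finset.sum_mul]; ring
  have hβU (n : ℕ) : ∑ t ∈ Finset.Icc (1 : ℤ) n, β n t ^ 2 ≤ U n := by
    calc _ ≤ ∑ t ∈ Finset.Icc (1 : ℤ) n, 1 / (n : ℝ) * (2 * q) ^ 2 *
          ((∑ m, c m ^ 2) * ∑ m, a n t m ^ 2) := by
          refine Finset.sum_le_sum fun t _ => ?_
          rw [hβdef, mul_pow, mul_pow, sq (√(n : ℝ))⁻¹, inv_sqrt_natCast_mul_self]
          refine mul_le_mul_of_nonneg_left ?_ (by positivity)
          simpa only [sq_abs] using Finset.sum_mul_sq_le_sq_mul_sq Finset.univ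
            (fun m => |c m|) fun m => |a n t m|
      _ = _ := by
          rw [hUdef]
          simp only [weightCross_zero_eq]
          rw [← Finset.mul_sum, ← Finset.mul_sum, ← Finset.mul_sum, Finset.sum_comm]
          ring
  have hblim : Tendsto b atTop (𝓝 0) := by
    simpa using hW2.tendsto_div_nhds_zero.const_mul (2 * q * (∑ m, |c m|))
  have hUlim : Tendsto U atTop (𝓝 ((2 * q) ^ 2 * (∑ m, c m ^ 2) * ∑ m, G m m 0)) :=
    (tendsto_finsetSum _ fun m _ => hW1 m m 0).const_mul _
  have hξm (n : ℕ) (t : ℤ) : Measurable[⨆ i ∈ Set.Ioc (t - q : ℤ) t,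
      MeasurableSpace.comap (fun z : ℤ → E => z i) inferInstance] (ξ n t) :=
    Finset.measurable_fun_sum _ fun m _ =>
      ((measurable_obsTrunc_timeShift (hf m).continuous B q t).sub_const _).const_mul _
  have hξ0 (n : ℕ) (t : ℤ) : ∫ z, ξ n t z ∂(iidLaw ℤ μ) = 0 := by
    have hi (m : Fin M) : Integrable (fun z => obsTrunc (f m) B q (timeShift t z)) (iidLaw ℤ μ) :=
      (memLp_obsTrunc_timeShift (hf m).continuous B q t).integrable (by norm_num)
    have hint (m : Fin M) : Integrable (fun z => (√(n : ℝ))⁻¹ * c m * a n t m *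
        (obsTrunc (f m) B q (timeShift t z) - mean m)) (iidLaw ℤ μ) :=
      ((hi m).sub (integrable_const _)).const_mul _
    simp only [hξdef]
    rw [integral_finsetSum _ fun m _ => hint m]
    refine Finset.sum_eq_zero fun m _ => ?_
    rw [integral_const_mul, integral_sub (hi m) (integrable_const _),
      (measurePreserving_timeShift μ t).integral_comp_of_aestronglyMeasurable
        (memLp_obsTrunc (hf m).continuous B q).1]
    simp [hmean]
  have hlin (n : ℕ) (z : ℤ → E) : linComb μ a (fun m => obsTrunc (f m) B q) c n z =
      ∑ t ∈ Finset.Icc (1 : ℤ) n, ξ n t z := linComb_eq_sum _ _ _ _ _ _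
  have herr (n : ℕ) : ‖∫ z, Complex.exp
      ((linComb μ a (fun m => obsTrunc (f m) B q) c n z : ℝ) * Complex.I) ∂(iidLaw ℤ μ) -
      (Real.exp (-(∫ z, linComb μ a (fun m => obsTrunc (f m) B q) c n z ^ 2 ∂(iidLaw ℤ μ)) / 2) : ℂ)‖
      ≤ √(96 * q ^ 3 * b n ^ 2 * U n) + 12 * q ^ 2 * b n * U n := by
    simp only [hlin]
    refine (norm_integral_exp_sum_sub_exp_variance_le (fun i => (measurable_pi_apply i).comap_le)
      (iIndep_coord μ) (hb0 n) (fun t _ => hξm n t) (fun t _ => hξβ n t) (fun t _ => hβb n t)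
      fun t _ => hξ0 n t).trans ?_
    have := hb0 n
    exact add_le_add (Real.sqrt_le_sqrt (mul_le_mul_of_nonneg_left (hβU n) (by positivity)))
      (mul_le_mul_of_nonneg_left (hβU n) (by positivity))
  have herrlim : Tendsto (fun n => √(96 * q ^ 3 * b n ^ 2 * U n) + 12 * q ^ 2 * b n * U n) atTop
      (𝓝 0) := by
    have h1 := ((((hblim.pow 2).const_mul (96 * (q : ℝ) ^ 3)).mul hUlim).sqrt).add
      ((hblim.const_mul (12 * (q : ℝ) ^ 2)).mul hUlim)
    simpa using h1
  have h0 := squeeze_zero_norm herr herrlim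
  have hexp : Tendsto (fun n => (Real.exp (-(∫ z,
      linComb μ a (fun m => obsTrunc (f m) B q) c n z ^ 2 ∂(iidLaw ℤ μ)) / 2) : ℂ)) atTop
      (𝓝 (Real.exp (-(limitVar μ G (fun m => obsTrunc (f m) B q) c) / 2) : ℂ)) :=
    (Complex.continuous_ofReal.tendsto _).comp
      ((Real.continuous_exp.tendsto _).comp (hvar.neg.div_const 2))
  simpa using h0.add hexp

end TruncatedLimit

/-! ### Limits of the weight products and $L^2$ comparison of characteristic functions. -/

section FullLimit

theorem norm_integral_exp_mul_I_sub_le {Ω : Type*} {mΩ : MeasurableSpace Ω} {P : Measure Ω}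
    [IsProbabilityMeasure P] {u v : Ω → ℝ} (hu : MemLp u 2 P) (hv : MemLp v 2 P) :
    ‖∫ ω, Complex.exp ((u ω : ℝ) * Complex.I) ∂P - ∫ ω, Complex.exp ((v ω : ℝ) * Complex.I) ∂P‖ ≤
      lpNorm (fun ω => u ω - v ω) 2 P := by
  have hint {w : Ω → ℝ} (hw : MemLp w 2 P) :
      Integrable (fun ω => Complex.exp ((w ω : ℝ) * Complex.I)) P := by
    refine Integrable.of_bound (C := 1) ?_ (.of_forall fun ω => ?_)
    · exact (by fun_prop : Continuous fun x : ℝ => Complex.exp ((x : ℝ) * Complex.I))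
        |>.comp_aestronglyMeasurable hw.1
    · rw [Complex.norm_exp_ofReal_mul_I]
  rw [← integral_sub (hint hu) (hint hv)]
  refine (norm_integral_le_of_norm_le ((hu.sub hv).integrable (by norm_num)).abs
    (.of_forall fun ω => norm_exp_mul_I_sub_exp_mul_I_le _ _)).trans ?_
  exact integral_abs_le_lpNorm_two (hu.sub hv)

variable {E : Type*} [MeasurableSpace E] {M : ℕ} {μ : Measure E} [IsProbabilityMeasure μ]
  {a : ℕ → ℤ → Fin M → ℝ} {G : Fin M → Fin M → ℤ → ℝ}

theorem memLp_linComb {H : Fin M → (ℤ → E) → ℝ} (hH : ∀ m, MemLp (H m) 2 (iidLaw ℤ μ))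
    (a : ℕ → ℤ → Fin M → ℝ) (c : Fin M → ℝ) (n : ℕ) :
    MemLp (linComb μ a H c n) 2 (iidLaw ℤ μ) :=
  (memLp_finsetSum _ fun m _ => (memLp_finsetSum _ fun t _ =>
    (((hH m).comp_measurePreserving (measurePreserving_timeShift μ t)).sub
      (memLp_const _)).const_mul _).const_mul _).const_mul _

theorem abs_limit_weightCross_le
    (ha : ∀ (n : ℕ) (t : ℤ) (m : Fin M), t ∉ Set.Icc (1 : ℤ) n → a n t m = 0)
    (hW1 : ∀ m l h, Tendsto (weightCross a m l h) atTop (𝓝 (G m l h))) (m l : Fin M) (h : ℤ) :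
    |G m l h| ≤ (G m m 0 + G l l 0) / 2 :=
  le_of_tendsto_of_tendsto (hW1 m l h).abs (((hW1 m m 0).add (hW1 l l 0)).div_const 2)
    (.of_forall fun n => abs_weightCross_le ha m l h n)

theorem limit_weightCross_neg
    (ha : ∀ (n : ℕ) (t : ℤ) (m : Fin M), t ∉ Set.Icc (1 : ℤ) n → a n t m = 0)
    (hW1 : ∀ m l h, Tendsto (weightCross a m l h) atTop (𝓝 (G m l h))) (m l : Fin M) (h : ℤ) :
    G m l (-h) = G l m h :=
  tendsto_nhds_unique ((hW1 m l (-h)).congr fun n => weightCross_neg ha m l h n) (hW1 l m h)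

end FullLimit

/-! ### Removal of the truncation. -/

section FullLimit

variable {E : Type*} [NormedAddCommGroup E] [NormedSpace ℝ E] [MeasurableSpace E] [BorelSpace E]
  [SecondCountableTopology E] {μ : Measure E} [IsProbabilityMeasure μ] {B : ℕ → E →L[ℝ] E}

theorem abs_autoCov_obsTrunc_le {f g : E → ℝ} {K L : ℝ≥0} (hf : LipschitzWith K f)
    (hg : LipschitzWith L g) (hB : Summable fun j => ‖B j‖) (hμ : MemLp (fun x : E => x) 2 μ)
    (q : ℕ) (h : ℤ) :
    |autoCov μ (obsTrunc f B q) (obsTrunc g B q) h| ≤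
      2 * K * L * lpNorm (fun x : E => x) 2 μ ^ 2 * autoCorr (coeffNorm B) h := by
  simpa only [autoCov, timeShift_zero, sub_zero] using abs_covariance_obsTrunc_le hf hg hB hμ q q 0 h

variable [CompleteSpace E]

theorem tendsto_autoCov_obsTrunc {f g : E → ℝ} {K L : ℝ≥0} (hf : LipschitzWith K f)
    (hg : LipschitzWith L g) (hB : Summable fun j => ‖B j‖) (hμ : MemLp (fun x : E => x) 2 μ)
    (h : ℤ) :
    Tendsto (fun q => autoCov μ (obsTrunc f B q) (obsTrunc g B q) h) atTop
      (𝓝 (autoCov μ (obsFull f B) (obsFull g B) h)) := by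
  simpa only [autoCov, timeShift_zero] using tendsto_covariance_obsTrunc hf hg hB hμ 0 h

theorem abs_autoCov_obsFull_le {f g : E → ℝ} {K L : ℝ≥0} (hf : LipschitzWith K f)
    (hg : LipschitzWith L g) (hB : Summable fun j => ‖B j‖) (hμ : MemLp (fun x : E => x) 2 μ)
    (h : ℤ) :
    |autoCov μ (obsFull f B) (obsFull g B) h| ≤
      2 * K * L * lpNorm (fun x : E => x) 2 μ ^ 2 * autoCorr (coeffNorm B) h :=
  le_of_tendsto (tendsto_autoCov_obsTrunc hf hg hB hμ h).abs
    (.of_forall fun q => abs_autoCov_obsTrunc_le hf hg hB hμ q h)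

variable {M : ℕ} {a : ℕ → ℤ → Fin M → ℝ} {G : Fin M → Fin M → ℤ → ℝ} {f : Fin M → E → ℝ}
  {K : Fin M → ℝ≥0}

theorem summable_mul_autoCov_obsFull
    (ha : ∀ (n : ℕ) (t : ℤ) (m : Fin M), t ∉ Set.Icc (1 : ℤ) n → a n t m = 0)
    (hW1 : ∀ m l h, Tendsto (weightCross a m l h) atTop (𝓝 (G m l h)))
    (hf : ∀ m, LipschitzWith (K m) (f m)) (hB : Summable fun j => ‖B j‖)
    (hμ : MemLp (fun x : E => x) 2 μ) (m l : Fin M) :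
    Summable fun h : ℤ => G m l h * autoCov μ (obsFull (f m) B) (obsFull (f l) B) h := by
  refine .of_norm_bounded (((summable_autoCorr (summable_coeffNorm hB)
    (coeffNorm_nonneg B)).mul_left (2 * K m * K l * lpNorm (fun x : E => x) 2 μ ^ 2)).mul_left
      ((G m m 0 + G l l 0) / 2)) fun h => ?_
  have hG := abs_limit_weightCross_le ha hW1 m l h
  rw [norm_mul]
  exact mul_le_mul hG (abs_autoCov_obsFull_le (hf m) (hf l) hB hμ h) (norm_nonneg _)
    ((abs_nonneg _).trans hG)

/-- Dominated convergence over lags: $G$ is bounded, and the covariances have a summable majorant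
independent of $q$. -/
theorem tendsto_limitVar_obsTrunc
    (ha : ∀ (n : ℕ) (t : ℤ) (m : Fin M), t ∉ Set.Icc (1 : ℤ) n → a n t m = 0)
    (hW1 : ∀ m l h, Tendsto (weightCross a m l h) atTop (𝓝 (G m l h)))
    (hf : ∀ m, LipschitzWith (K m) (f m)) (hB : Summable fun j => ‖B j‖)
    (hμ : MemLp (fun x : E => x) 2 μ) (c : Fin M → ℝ) :
    Tendsto (fun q => limitVar μ G (fun m => obsTrunc (f m) B q) c) atTop
      (𝓝 (limitVar μ G (fun m => obsFull (f m) B) c)) := by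
  refine tendsto_finsetSum _ fun m _ => tendsto_finsetSum _ fun l _ => Tendsto.const_mul _ ?_
  refine tendsto_tsum_of_dominated_convergence (((summable_autoCorr (summable_coeffNorm hB)
    (coeffNorm_nonneg B)).mul_left (2 * K m * K l * lpNorm (fun x : E => x) 2 μ ^ 2)).mul_left
      ((G m m 0 + G l l 0) / 2))
    (fun h => (tendsto_autoCov_obsTrunc (hf m) (hf l) hB hμ h).const_mul _)
    (.of_forall fun q h => ?_)
  have hG := abs_limit_weightCross_le ha hW1 m l h
  rw [norm_mul]
  exact mul_le_mul hG (abs_autoCov_obsTrunc_le (hf m) (hf l) hB hμ q h) (norm_nonneg _)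
    ((abs_nonneg _).trans hG)

/-- It is an iterated limit, in $n$ and then in $q$, of second moments. Positive semidefiniteness of
the limiting matrix comes from here. -/
theorem limitVar_obsFull_nonneg
    (ha : ∀ (n : ℕ) (t : ℤ) (m : Fin M), t ∉ Set.Icc (1 : ℤ) n → a n t m = 0)
    (hW1 : ∀ m l h, Tendsto (weightCross a m l h) atTop (𝓝 (G m l h)))
    (hf : ∀ m, LipschitzWith (K m) (f m)) (hB : Summable fun j => ‖B j‖)
    (hμ : MemLp (fun x : E => x) 2 μ) (c : Fin M → ℝ) :
    0 ≤ limitVar μ G (fun m => obsFull (f m) B) c :=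
  ge_of_tendsto' (tendsto_limitVar_obsTrunc ha hW1 hf hB hμ c) fun q =>
    ge_of_tendsto' (tendsto_integral_linComb_obsTrunc_sq ha hf hW1 q c) fun _ =>
      integral_nonneg fun _ => sq_nonneg _

theorem eventually_lpNorm_linComb_sub_le (hf : ∀ m, LipschitzWith (K m) (f m))
    (hB : Summable fun j => ‖B j‖) (hμ : MemLp (fun x : E => x) 2 μ)
    (a : ℕ → ℤ → Fin M → ℝ) (c : Fin M → ℝ) {ε : ℝ} (hε : 0 < ε) :
    ∀ᶠ q in atTop, ∀ n, lpNorm (fun z => linComb μ a (fun m => obsFull (f m) B) c n z -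
      linComb μ a (fun m => obsTrunc (f m) B q) c n z) 2 (iidLaw ℤ μ) ≤
        ε * ∑ m, |c m| * √(weightCross a m m 0 n) := by
  filter_upwards [eventually_all.2 fun m => eventually_lpNorm_weighted_sum_le (hf m) hB hμ hε]
    with q hq n
  set D : Fin M → (ℤ → E) → ℝ := fun m z =>
    ∑ t ∈ Finset.Icc (1 : ℤ) n, a n t m *
      (obsFull (f m) B (timeShift t z) - ∫ x, obsFull (f m) B x ∂(iidLaw ℤ μ)) -
    ∑ t ∈ Finset.Icc (1 : ℤ) n, a n t m *
      (obsTrunc (f m) B q (timeShift t z) - ∫ x, obsTrunc (f m) B q x ∂(iidLaw ℤ μ)) with hD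
  have hDm (m : Fin M) : MemLp (D m) 2 (iidLaw ℤ μ) :=
    (memLp_finsetSum _ fun t _ => (((memLp_obsFull (hf m) hB hμ).comp_measurePreserving
      (measurePreserving_timeShift μ t)).sub (memLp_const _)).const_mul _).sub
    (memLp_finsetSum _ fun t _ => ((memLp_obsTrunc_timeShift (hf m).continuous B q t).sub
      (memLp_const _)).const_mul _)
  have heq : (fun z => linComb μ a (fun m => obsFull (f m) B) c n z -
      linComb μ a (fun m => obsTrunc (f m) B q) c n z) =
      ∑ m, fun z => ((√(n : ℝ))⁻¹ * c m) * D m z := by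
    ext z
    simp only [linComb, hD, Finset.sum_apply, Finset.mul_sum, ← Finset.sum_sub_distrib]
    refine Finset.sum_congr rfl fun m _ => Finset.sum_congr rfl fun t _ => by ring
  rw [heq]
  refine (lpNorm_sum_le (fun m _ => (hDm m).const_mul _) (by norm_num)).trans ?_
  rw [Finset.mul_sum]
  refine Finset.sum_le_sum fun m _ => ?_
  rw [lpNorm_const_mul, abs_mul, abs_of_nonneg (by positivity : 0 ≤ (√(n : ℝ))⁻¹),
    weightCross_zero_eq, Real.sqrt_mul (by positivity), one_div, Real.sqrt_inv]
  calc _ ≤ (√(n : ℝ))⁻¹ * |c m| * (ε * √(∑ t ∈ Finset.Icc (1 : ℤ) n, a n t m ^ 2)) :=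
        mul_le_mul_of_nonneg_left (hq m _ _) (by positivity)
    _ = _ := by ring

/-- The central limit theorem for the linear combinations of weighted sums, on the space of
innovation sequences. -/
theorem tendsto_integral_exp_linComb_obsFull
    (ha : ∀ (n : ℕ) (t : ℤ) (m : Fin M), t ∉ Set.Icc (1 : ℤ) n → a n t m = 0)
    (hf : ∀ m, LipschitzWith (K m) (f m)) (hB : Summable fun j => ‖B j‖)
    (hμ : MemLp (fun x : E => x) 2 μ)
    (hW1 : ∀ m l h, Tendsto (weightCross a m l h) atTop (𝓝 (G m l h)))
    (hW2 : weightMax a =o[atTop] fun n : ℕ => √(n : ℝ)) (c : Fin M → ℝ) :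
    Tendsto (fun n => ∫ z, Complex.exp
      ((linComb μ a (fun m => obsFull (f m) B) c n z : ℝ) * Complex.I) ∂(iidLaw ℤ μ)) atTop
      (𝓝 (Real.exp (-(limitVar μ G (fun m => obsFull (f m) B) c) / 2) : ℂ)) := by
  refine tendsto_of_forall_approx
    (fun q => tendsto_integral_exp_linComb_obsTrunc ha hf hW1 hW2 q c)
    ((Complex.continuous_ofReal.tendsto _).comp ((Real.continuous_exp.tendsto _).comp
      ((tendsto_limitVar_obsTrunc ha hW1 hf hB hμ c).neg.div_const 2))) fun ε hε => ?_
  have hlim : Tendsto (fun n => ∑ m, |c m| * √(weightCross a m m 0 n)) atTop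
      (𝓝 (∑ m, |c m| * √(G m m 0))) :=
    tendsto_finsetSum _ fun m _ => ((hW1 m m 0).sqrt).const_mul _
  have hC0 : 0 ≤ ∑ m, |c m| * √(G m m 0) := by positivity
  set C := ∑ m, |c m| * √(G m m 0) with hC
  -- The weight norms converge to `C`, so they are eventually below `C + 1`; this is also a positive
  -- divisor when `C` is zero.
  filter_upwards [eventually_lpNorm_linComb_sub_le hf hB hμ a c
    (div_pos hε (by positivity : 0 < C + 1))] with q hq
  filter_upwards [hlim.eventually_le_const (lt_add_one C)] with n hn
  rw [dist_eq_norm]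
  refine (norm_integral_exp_mul_I_sub_le (memLp_linComb (fun m => memLp_obsFull (hf m) hB hμ) a c n)
    (memLp_linComb (fun m => memLp_obsTrunc (hf m).continuous B q) a c n)).trans ((hq n).trans ?_)
  calc _ ≤ ε / (C + 1) * (C + 1) := mul_le_mul_of_nonneg_left hn (by positivity)
    _ = ε := div_mul_cancel₀ _ (by positivity)

end FullLimit

/-! ### Transfer to the given probability space. -/

section Transfer

theorem covariance_congr_ae {Ω : Type*} {mΩ : MeasurableSpace Ω} {P : Measure Ω}
    {F F' H H' : Ω → ℝ} (hF : F =ᵐ[P] F') (hH : H =ᵐ[P] H') : cov[F, H; P] = cov[F', H'; P] := by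
  rw [covariance, covariance, integral_congr_ae hF, integral_congr_ae hH]
  refine integral_congr_ae ?_
  filter_upwards [hF, hH] with ω h1 h2
  rw [h1, h2]

theorem sum_Icc_one_natCast (F : ℤ → ℝ) (n : ℕ) :
    ∑ t ∈ Finset.Icc 1 n, F (t : ℤ) = ∑ t ∈ Finset.Icc (1 : ℤ) n, F t := by
  refine Finset.sum_bij (fun t _ => (t : ℤ)) (fun t ht => ?_) (fun s _ t _ h => by exact_mod_cast h)
    (fun t ht => ⟨t.toNat, ?_⟩) fun _ _ => rfl
  · rw [Finset.mem_Icc] at ht ⊢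
    omega
  · rw [Finset.mem_Icc] at ht
    refine ⟨?_, by omega⟩
    rw [Finset.mem_Icc]
    omega

variable {Ω : Type*} [MeasurableSpace Ω] {P : Measure Ω} {k M : ℕ}
  {A : ℕ → Matrix (Fin k) (Fin k) ℝ} {Z : ℤ → Ω → EuclideanSpace ℝ (Fin k)}
  {X : ℕ → Ω → EuclideanSpace ℝ (Fin k)} {f : Fin M → EuclideanSpace ℝ (Fin k) → ℝ}
  {K : Fin M → ℝ≥0} {a : ℕ → ℤ → Fin M → ℝ} {G : Fin M → Fin M → ℤ → ℝ}

namespace IsLinearProcess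

theorem memLp_id_map (hX : IsLinearProcess P A Z X) :
    MemLp (fun x : EuclideanSpace ℝ (Fin k) => x) 2 (P.map (Z 0)) :=
  (memLp_map_measure_iff aestronglyMeasurable_id
    (hX.measurable_innovation 0).aemeasurable).2 hX.memLp_two

theorem measurePreserving_innovations (hX : IsLinearProcess P A Z X) :
    MeasurePreserving (fun ω t => Z t ω) P (iidLaw ℤ (P.map (Z 0))) := by
  refine ⟨measurable_pi_iff.2 hX.measurable_innovation, ?_⟩
  rw [hX.indep.map_fun_eq_infinitePi_map hX.measurable_innovation]
  simp only [fun t => (hX.identDistrib t).map_eq]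

theorem comp_ae_eq_obsFull (hX : IsLinearProcess P A Z X) (g : EuclideanSpace ℝ (Fin k) → ℝ)
    {t : ℕ} (ht : 1 ≤ t) :
    (fun ω => g (X t ω)) =ᵐ[P] fun ω => obsFull g (fun j => Matrix.toEuclideanCLM (𝕜 := ℝ) (A j))
      (timeShift t fun s => Z s ω) := by
  filter_upwards [hX.eq_series t ht] with ω hω
  simp only [hω, obsFull, linFull, timeShift, neg_add_eq_sub]

variable [IsProbabilityMeasure P]

theorem isProbabilityMeasure_map (hX : IsLinearProcess P A Z X) :
    IsProbabilityMeasure (P.map (Z 0)) :=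
  Measure.isProbabilityMeasure_map (hX.measurable_innovation 0).aemeasurable

theorem memLp_comp (hX : IsLinearProcess P A Z X) {g : EuclideanSpace ℝ (Fin k) → ℝ} {L : ℝ≥0}
    (hg : LipschitzWith L g) {t : ℕ} (ht : 1 ≤ t) : MemLp (fun ω => g (X t ω)) 2 P := by
  have := hX.isProbabilityMeasure_map
  exact (((memLp_obsFull hg hX.summable_norm hX.memLp_id_map).comp_measurePreserving
    (measurePreserving_timeShift _ t)).comp_measurePreserving
      hX.measurePreserving_innovations).ae_eq (hX.comp_ae_eq_obsFull g ht).symm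

theorem integral_comp (hX : IsLinearProcess P A Z X) {g : EuclideanSpace ℝ (Fin k) → ℝ} {L : ℝ≥0}
    (hg : LipschitzWith L g) {t : ℕ} (ht : 1 ≤ t) : ∫ ω, g (X t ω) ∂P =
      ∫ z, obsFull g (fun j => Matrix.toEuclideanCLM (𝕜 := ℝ) (A j)) z
        ∂(iidLaw ℤ (P.map (Z 0))) := by
  have := hX.isProbabilityMeasure_map
  rw [integral_congr_ae (hX.comp_ae_eq_obsFull g ht)]
  exact ((measurePreserving_timeShift _ t).comp
    hX.measurePreserving_innovations).integral_comp_of_aestronglyMeasurable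
      (memLp_obsFull hg hX.summable_norm hX.memLp_id_map).1

theorem lagCov_eq_autoCov (hX : IsLinearProcess P A Z X) (hf : ∀ m, LipschitzWith (K m) (f m))
    (m l : Fin M) (h : ℕ) : lagCov P X f m l h = autoCov (P.map (Z 0))
      (obsFull (f m) fun j => Matrix.toEuclideanCLM (𝕜 := ℝ) (A j))
      (obsFull (f l) fun j => Matrix.toEuclideanCLM (𝕜 := ℝ) (A j)) h := by
  have := hX.isProbabilityMeasure_map
  have hζ := hX.measurePreserving_innovations
  have hmeas (m : Fin M) := (memLp_obsFull (hf m) hX.summable_norm hX.memLp_id_map).1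
  have hmeas' (m : Fin M) (t : ℕ) :=
    (hmeas m).comp_measurePreserving (measurePreserving_timeShift (P.map (Z 0)) t)
  rw [lagCov, covariance_congr_ae (hX.comp_ae_eq_obsFull (f m) le_rfl)
    (hX.comp_ae_eq_obsFull (f l) (Nat.le_add_right 1 h))]
  have h1 := covariance_map_fun (μ := P) (Z := fun ω t => Z t ω)
    (hζ.map_eq.symm ▸ hmeas' m 1) (hζ.map_eq.symm ▸ hmeas' l (1 + h)) hζ.measurable.aemeasurable
  refine h1.symm.trans ?_
  rw [hζ.map_eq]
  refine (covariance_timeShift (hmeas m) (hmeas l) _ _).trans ?_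
  congr 1
  push_cast
  ring

/-- Split $\mathbb Z$ into positive, zero and negative lags. Reversing the lag exchanges $m$ and
$\ell$ both in $G$ and in the covariance, so the negative half is the positive half of the
transposed entry. This is why the limit is the symmetric part of the one-sided matrix. -/
theorem limitCov_apply (hX : IsLinearProcess P A Z X)
    (ha : ∀ (n : ℕ) (t : ℤ) (m : Fin M), t ∉ Set.Icc (1 : ℤ) n → a n t m = 0)
    (hW1 : ∀ m l h, Tendsto (weightCross a m l h) atTop (𝓝 (G m l h)))
    (hf : ∀ m, LipschitzWith (K m) (f m)) (m l : Fin M) :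
    limitCov P X f G m l = ∑' h : ℤ, G m l h * autoCov (P.map (Z 0))
      (obsFull (f m) fun j => Matrix.toEuclideanCLM (𝕜 := ℝ) (A j))
      (obsFull (f l) fun j => Matrix.toEuclideanCLM (𝕜 := ℝ) (A j)) h := by
  have := hX.isProbabilityMeasure_map
  have hmeas (m : Fin M) := (memLp_obsFull (hf m) hX.summable_norm hX.memLp_id_map).1
  set u : Fin M → Fin M → ℤ → ℝ := fun m l h => G m l h * autoCov (P.map (Z 0))
      (obsFull (f m) fun j => Matrix.toEuclideanCLM (𝕜 := ℝ) (A j))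
      (obsFull (f l) fun j => Matrix.toEuclideanCLM (𝕜 := ℝ) (A j)) h with hu
  have hneg (m l : Fin M) (h : ℤ) : u m l (-h) = u l m h := by
    simp only [hu]
    rw [limit_weightCross_neg ha hW1, autoCov_neg (hmeas m) (hmeas l)]
  have hsum (m l : Fin M) : Summable fun h : ℕ => u m l ((h : ℤ) + 1) :=
    (summable_mul_autoCov_obsFull ha hW1 hf hX.summable_norm hX.memLp_id_map m l).comp_injective
      fun i j hij => by simpa using hij
  have hlong (m l : Fin M) : longRunMatrix P X f G m l =
      u m l 0 + 2 * ∑' h : ℕ, u m l ((h : ℤ) + 1) := by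
    simp only [longRunMatrix, Matrix.of_apply, hX.lagCov_eq_autoCov hf, hu, Nat.cast_add,
      Nat.cast_one, Nat.cast_zero]
  change _ = ∑' h : ℤ, u m l h
  rw [tsum_of_add_one_of_neg_add_one (hsum m l) (by simpa only [hneg] using hsum l m)]
  simp only [hneg, limitCov, Matrix.smul_apply, Matrix.add_apply, Matrix.transpose_apply, hlong,
    smul_eq_mul]
  have h0 := hneg m l 0
  rw [neg_zero] at h0
  rw [h0]
  ring

theorem dotProduct_limitCov_mulVec (hX : IsLinearProcess P A Z X)
    (ha : ∀ (n : ℕ) (t : ℤ) (m : Fin M), t ∉ Set.Icc (1 : ℤ) n → a n t m = 0)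
    (hW1 : ∀ m l h, Tendsto (weightCross a m l h) atTop (𝓝 (G m l h)))
    (hf : ∀ m, LipschitzWith (K m) (f m)) (c : Fin M → ℝ) :
    c ⬝ᵥ (limitCov P X f G).mulVec c = limitVar (P.map (Z 0)) G
      (fun m => obsFull (f m) fun j => Matrix.toEuclideanCLM (𝕜 := ℝ) (A j)) c := by
  simp only [dotProduct, Matrix.mulVec, limitVar, hX.limitCov_apply ha hW1 hf, Finset.mul_sum]
  exact Finset.sum_congr rfl fun m _ => Finset.sum_congr rfl fun l _ => by ring

theorem posSemidef_limitCov (hX : IsLinearProcess P A Z X)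
    (ha : ∀ (n : ℕ) (t : ℤ) (m : Fin M), t ∉ Set.Icc (1 : ℤ) n → a n t m = 0)
    (hW1 : ∀ m l h, Tendsto (weightCross a m l h) atTop (𝓝 (G m l h)))
    (hf : ∀ m, LipschitzWith (K m) (f m)) : (limitCov P X f G).PosSemidef := by
  have := hX.isProbabilityMeasure_map
  refine Matrix.posSemidef_iff_dotProduct_mulVec.2 ⟨?_, fun c => ?_⟩
  · rw [Matrix.IsHermitian, Matrix.conjTranspose_eq_transpose_of_trivial, limitCov,
      Matrix.transpose_smul, Matrix.transpose_add, Matrix.transpose_transpose, add_comm]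
  · rw [star_trivial, hX.dotProduct_limitCov_mulVec ha hW1 hf]
    exact limitVar_obsFull_nonneg ha hW1 hf hX.summable_norm hX.memLp_id_map c

theorem sum_weightedSum_ae_eq_linComb (hX : IsLinearProcess P A Z X)
    (hf : ∀ m, LipschitzWith (K m) (f m)) (a : ℕ → ℤ → Fin M → ℝ) (c : Fin M → ℝ) (n : ℕ) :
    (fun ω => ∑ m, c m * ((√(n : ℝ))⁻¹ * weightedSum P X f a n m ω)) =ᵐ[P] fun ω =>
      linComb (P.map (Z 0)) a
        (fun m => obsFull (f m) fun j => Matrix.toEuclideanCLM (𝕜 := ℝ) (A j)) c n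
        fun t => Z t ω := by
  have h : ∀ᵐ ω ∂P, ∀ m, ∀ t ∈ Finset.Icc 1 n, f m (X t ω) = obsFull (f m)
      (fun j => Matrix.toEuclideanCLM (𝕜 := ℝ) (A j)) (timeShift t fun s => Z s ω) :=
    ae_all_iff.2 fun m => (Finset.eventually_all _).2 fun t ht =>
      hX.comp_ae_eq_obsFull (f m) (Finset.mem_Icc.1 ht).1
  filter_upwards [h] with ω hω
  simp only [linComb, Finset.mul_sum (s := Finset.univ)]
  refine Finset.sum_congr rfl fun m _ => ?_
  rw [weightedSum, ← sum_Icc_one_natCast fun t => a n t m * (obsFull (f m)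
    (fun j => Matrix.toEuclideanCLM (𝕜 := ℝ) (A j)) (timeShift t fun s => Z s ω) -
    ∫ z, obsFull (f m) (fun j => Matrix.toEuclideanCLM (𝕜 := ℝ) (A j)) z
      ∂(iidLaw ℤ (P.map (Z 0)))), ← mul_assoc, ← mul_assoc, mul_comm (c m)]
  congr 1
  refine Finset.sum_congr rfl fun t ht => ?_
  rw [hω m t ht, hX.integral_comp (hf m) (Finset.mem_Icc.1 ht).1]

theorem aemeasurable_weightedSum (hX : IsLinearProcess P A Z X)
    (hf : ∀ m, LipschitzWith (K m) (f m)) (a : ℕ → ℤ → Fin M → ℝ) (n : ℕ) (m : Fin M) :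
    AEMeasurable (weightedSum P X f a n m) P :=
  Finset.aemeasurable_fun_sum _ fun _ ht =>
    ((hX.memLp_comp (hf m) (Finset.mem_Icc.1 ht).1).aestronglyMeasurable.aemeasurable.sub_const
      _).const_mul _

/-- Lévy's continuity theorem: the characteristic function at $x$ is that of the linear combination
with coefficients $x$ at frequency $1$, so the scalar limit applies directly. -/
theorem tendstoInDistribution_weightedSum (hX : IsLinearProcess P A Z X)
    (ha : ∀ (n : ℕ) (t : ℤ) (m : Fin M), t ∉ Set.Icc (1 : ℤ) n → a n t m = 0)
    (hW1 : ∀ m l h, Tendsto (weightCross a m l h) atTop (𝓝 (G m l h)))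
    (hW2 : weightMax a =o[atTop] fun n : ℕ => √(n : ℝ))
    (hf : ∀ m, LipschitzWith (K m) (f m)) :
    TendstoInDistribution
      (fun (n : ℕ) ω => WithLp.toLp 2 fun m : Fin M => (√(n : ℝ))⁻¹ * weightedSum P X f a n m ω)
      atTop id (fun _ => P) (multivariateGaussian 0 (limitCov P X f G)) := by
  have := hX.isProbabilityMeasure_map
  have hmeas (n : ℕ) : AEMeasurable (fun ω => WithLp.toLp 2 fun m : Fin M =>
      (√(n : ℝ))⁻¹ * weightedSum P X f a n m ω) P :=
    (WithLp.measurable_toLp 2 _).comp_aemeasurable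
      (aemeasurable_pi_iff.2 fun m => (hX.aemeasurable_weightedSum hf a n m).const_mul _)
  refine ⟨hmeas, aemeasurable_id, ProbabilityMeasure.tendsto_of_tendsto_charFun fun x => ?_⟩
  simp only [ProbabilityMeasure.coe_mk, Measure.map_id]
  rw [charFun_multivariateGaussian (hX.posSemidef_limitCov ha hW1 hf)]
  have hlim := tendsto_integral_exp_linComb_obsFull ha hf hX.summable_norm hX.memLp_id_map hW1 hW2
    (WithLp.ofLp x)
  rw [← hX.dotProduct_limitCov_mulVec ha hW1 hf] at hlim
  have hgoal : Complex.exp (((inner ℝ x (0 : EuclideanSpace ℝ (Fin M)) : ℝ) : ℂ) * Complex.I -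
      ((WithLp.ofLp x ⬝ᵥ (limitCov P X f G).mulVec (WithLp.ofLp x) : ℝ) : ℂ) / 2) =
      (Real.exp (-(WithLp.ofLp x ⬝ᵥ (limitCov P X f G).mulVec (WithLp.ofLp x)) / 2) : ℂ) := by
    rw [inner_zero_right]
    push_cast
    ring_nf
  rw [hgoal]
  refine hlim.congr fun n => ?_
  have hexp : Continuous fun y : ℝ => Complex.exp ((y : ℝ) * Complex.I) := by fun_prop
  rw [charFun_apply, integral_map (hmeas n) (by fun_prop),
    ← hX.measurePreserving_innovations.integral_comp_of_aestronglyMeasurable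
      (hexp.comp_aestronglyMeasurable (memLp_linComb (fun m => memLp_obsFull (hf m)
        hX.summable_norm hX.memLp_id_map) a _ n).1)]
  refine integral_congr_ae ?_
  filter_upwards [hX.sum_weightedSum_ae_eq_linComb hf a (WithLp.ofLp x) n] with ω hω
  rw [← hω]
  simp [PiLp.inner_apply]

end IsLinearProcess

end Transfer

/-! ### The main theorem. -/

theorem theorem2p1 {Ω : Type*} [MeasurableSpace Ω] (P : Measure Ω) [IsProbabilityMeasure P]
    {k M : ℕ}
    (A : ℕ → Matrix (Fin k) (Fin k) ℝ) (Z : ℤ → Ω → EuclideanSpace ℝ (Fin k))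
    (X : ℕ → Ω → EuclideanSpace ℝ (Fin k)) (hX : IsLinearProcess P A Z X)
    (f : Fin M → EuclideanSpace ℝ (Fin k) → ℝ) (hf : ∀ m, ∃ K : ℝ≥0, LipschitzWith K (f m))
    (a : ℕ → ℤ → Fin M → ℝ) (ha : ∀ (n : ℕ) (t : ℤ) (m : Fin M), t ∉ Set.Icc (1 : ℤ) n → a n t m = 0)
    (G : Fin M → Fin M → ℤ → ℝ)
    (hW1 : ∀ m l h, Tendsto (weightCross a m l h) atTop (𝓝 (G m l h)))
    (hW2 : weightMax a =o[atTop] fun n : ℕ => √(n : ℝ)) :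
    (∀ t m, 1 ≤ t → MemLp (fun ω => f m (X t ω)) 2 P) ∧
    (∀ m l, Summable fun h : ℕ => G m l ((h : ℤ) + 1) * lagCov P X f m l (h + 1)) ∧
    (limitCov P X f G).PosSemidef ∧
    TendstoInDistribution
      (fun (n : ℕ) ω => WithLp.toLp 2 fun m : Fin M => (√(n : ℝ))⁻¹ * weightedSum P X f a n m ω)
      atTop id (fun _ => P) (multivariateGaussian 0 (limitCov P X f G)) := by
  choose K hK using hf
  have := hX.isProbabilityMeasure_map
  refine ⟨fun t m ht => hX.memLp_comp (hK m) ht, fun m l => ?_, hX.posSemidef_limitCov ha hW1 hK,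
    hX.tendstoInDistribution_weightedSum ha hW1 hW2 hK⟩
  simp only [hX.lagCov_eq_autoCov hK, Nat.cast_add, Nat.cast_one]
  exact (summable_mul_autoCov_obsFull ha hW1 hK hX.summable_norm hX.memLp_id_map
    m l).comp_injective (i := fun h : ℕ => (h : ℤ) + 1) fun i j hij => by simpa using hij
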